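/- Let $X$ be a non-empty proper CAT(0) space (that is, a geodesic metric space satisfying the Bruhat--Tits inequality $2d(m,x)^2\le d(c,x)^2+d(c',x)^2-\tfrac12 d(c,c')^2$ for all points $x,c,c'$ and every midpoint $m$ of a geodesic from $c$ to $c'$, in which closed balls are compact). Let $G=G_1\times\cdots\times G_n$ be any product of finitely many groups (no topology is assumed), and let $G$ act on $X$ by isometries. Let $\partial X$ be the boundary at infinity of $X$, i.e. the set of geodesic rays $[0,\infty)\to X$ modulo the relation of being at bounded distance from each other, with the induced $G$-action. Then at least one of the following holds: (1) $G$ has a fixed point in $\partial X$; (2) there is a non-empty closed convex $G$-invariant subset $Z\subseteq X$ which splits $G$-equivariantly and isometrically as a product of $G_i$-spaces: there are metric spaces $Z_1,\dots,Z_n$, where each $Z_i$ carries an action of $G_i$ by isometries, and a surjective isometry $\varphi$ from $Z$ onto $Z_1\times\cdots\times Z_n$ with the metric $d(z,z')^2=\sum_{i} d(z_i,z_i')^2$, such that $\varphi(gz)_i=g_i\,\varphi(z)_i$ for all $g=(g_1,\dots,g_n)\in G$, $z\in Z$ and all $i$. -/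

import Mathlib

open scoped NNReal

namespace CATZero

universe u v

section Geodesics

variable {X : Type u} [MetricSpace X]

/-- `σ` restricted to `[0, dist x y]` is a geodesic (i.e. isometric) segment from `x` to `y`. -/
structure IsGeodesicSegment (σ : ℝ → X) (x y : X) : Prop where
  isometric : ∀ s ∈ Set.Icc (0 : ℝ) (dist x y), ∀ t ∈ Set.Icc (0 : ℝ) (dist x y),
    dist (σ s) (σ t) = |s - t|
  source : σ 0 = x
  target : σ (dist x y) = y

/-- A subset of a metric space is (geodesically) convex if it contains every geodesic segment
joining any two of its points. -/
def IsConvex (A : Set X) : Prop :=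
  ∀ x ∈ A, ∀ y ∈ A, ∀ σ : ℝ → X, IsGeodesicSegment σ x y →
    ∀ t ∈ Set.Icc (0 : ℝ) (dist x y), σ t ∈ A

variable (X)

/-- A CAT(0) space: a geodesic metric space in which the midpoint `m` of any geodesic segment
from `c` to `c'` satisfies the Bruhat-Tits inequality
`2 d(m,x)² ≤ d(c',x)² + d(c,x)² - d(c',c)² / 2` for every point `x`. -/
structure IsCATZero : Prop where
  geodesic : ∀ x y : X, ∃ σ : ℝ → X, IsGeodesicSegment σ x y
  bruhat_tits : ∀ (x c c' : X) (σ : ℝ → X), IsGeodesicSegment σ c c' →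
    2 * dist (σ (dist c c' / 2)) x ^ 2 ≤
      dist c' x ^ 2 + dist c x ^ 2 - 1 / 2 * dist c' c ^ 2

/-- Geodesic rays: isometric maps `[0, ∞) → X`. -/
def GeodesicRay : Type u := {r : ℝ≥0 → X // Isometry r}

/-- Two rays are asymptotic if they remain at bounded distance from each other. -/
instance asymptotic : Setoid (GeodesicRay X) where
  r r₁ r₂ := ∃ C : ℝ, ∀ t : ℝ≥0, dist (r₁.1 t) (r₂.1 t) ≤ C
  iseqv :=
    { refl := fun r => ⟨0, fun t => (dist_self (r.1 t)).le⟩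
      symm := fun {r₁ r₂} ⟨C, h⟩ => ⟨C, fun t => (dist_comm (r₂.1 t) (r₁.1 t)).le.trans (h t)⟩
      trans := fun {r₁ r₂ r₃} ⟨C, h⟩ ⟨D, k⟩ => ⟨C + D, fun t =>
        (dist_triangle (r₁.1 t) (r₂.1 t) (r₃.1 t)).trans (add_le_add (h t) (k t))⟩ }

/-- The boundary at infinity `∂X`: asymptoty classes of geodesic rays in `X`. -/
def Boundary : Type u := Quotient (asymptotic X)

variable {X}

/-- An isometric action on `X` induces an action on geodesic rays. -/
instance rayMulAction {G : Type v} [Group G] [MulAction G X] [IsIsometricSMul G X] :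
    MulAction G (GeodesicRay X) where
  smul g r := ⟨fun t => g • r.1 t, (isometry_smul X g).comp r.2⟩
  one_smul r := Subtype.ext (funext fun t => one_smul G (r.1 t))
  mul_smul g h r := Subtype.ext (funext fun t => mul_smul g h (r.1 t))

/-- An isometric action on `X` induces an action on `∂X`. -/
instance boundaryMulAction {G : Type v} [Group G] [MulAction G X] [IsIsometricSMul G X] :
    MulAction G (Boundary X) where
  smul g := Quotient.map (fun r => g • r) fun _ _ ⟨C, h⟩ =>
    ⟨C, fun t => ((isometry_smul X g).dist_eq _ _).le.trans (h t)⟩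
  one_smul ξ := Quotient.inductionOn ξ fun r =>
    congrArg (Quotient.mk (asymptotic X)) (one_smul G r)
  mul_smul g h ξ := Quotient.inductionOn ξ fun r =>
    congrArg (Quotient.mk (asymptotic X)) (mul_smul g h r)

end Geodesics

/-- A metric space `Z` with an action of `G = ∏ i, G i` splits `G`-equivariantly and isometrically
as a product of `G i`-spaces: there are metric spaces `Y i` with an isometric action of `G i` and
a bijection `φ` from `Z` onto the product of the `Y i` which is isometric for the product metric
`d(y, y')² = ∑ i, d(y i, y' i)²` and satisfies `φ (g z) = (g i • φ z i)_i`. -/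
def SplitsEquivariantly {n : ℕ} (G : Fin n → Type v) [∀ i, Group (G i)]
    (Z : Type u) [MetricSpace Z] [MulAction (∀ i, G i) Z] : Prop :=
  ∃ (Y : Fin n → Type u) (_ : ∀ i, MetricSpace (Y i)) (_ : ∀ i, MulAction (G i) (Y i))
    (_ : ∀ i, IsIsometricSMul (G i) (Y i)) (φ : Z ≃ ∀ i, Y i),
    (∀ z w : Z, dist z w ^ 2 = ∑ i, dist (φ z i) (φ w i) ^ 2) ∧
      ∀ (g : ∀ i, G i) (z : Z) (i : Fin n), φ (g • z) i = g i • φ z i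

end CATZero

/-!
Suppose that every set of points which each element of the group moves by a bounded amount is
bounded. Split the group as `H × K`, with `H` the first factor and `K` the product of the others.
Weak compactness of bounded closed convex sets, applied to points which `K` moves no more than a
base point, then yields minimal non-empty closed convex `H`-invariant sets.

A convex continuous `H`-invariant function on a minimal set is constant. Hence distances between
minimal sets are constant, the projections between them are isometries, and any two of them span
flat rectangles. Projecting around a triangle of minimal sets is a translation of the first one by
a constant `δ`; its iterates move points at linear speed, and comparing with a path through the
other two sets forces `δ = 0`. The projections are therefore compatible, and the union of the
minimal sets is isometric to `C × T`, with `C` a minimal set and `T` a cross-section. Each element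
of `K` translates along `C` by a constant; the orbit of this translation is moved boundedly by both
`H` and `K`, so it is bounded and the translation is trivial. Thus `K` acts on `T` alone, without
moving an unbounded set boundedly, and induction on the number of factors applies.

If an unbounded set is moved boundedly and the space is proper, geodesics to points of the set
going to infinity subconverge to a ray, whose endpoint is fixed.
-/

namespace CATZero

universe u v

section Midpoints

variable {X Y : Type*} [MetricSpace X] [MetricSpace Y] {A : Set X} {m x y : X}

/-- `m` is a metric midpoint of `x` and `y`. Working with midpoints instead of geodesics keeps
parametrisations out of the arguments; for closed sets in a CAT(0) space the two resulting notions
of convexity agree. -/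
structure IsMidpoint (m x y : X) : Prop where
  dist_left : dist x m = dist x y / 2
  dist_right : dist y m = dist x y / 2

lemma IsMidpoint.symm (h : IsMidpoint m x y) : IsMidpoint m y x :=
  ⟨by rw [h.dist_right, dist_comm x y], by rw [h.dist_left, dist_comm x y]⟩

lemma IsMidpoint.map (h : IsMidpoint m x y) {f : X → Y} (hf : Isometry f) :
    IsMidpoint (f m) (f x) (f y) :=
  ⟨by rw [hf.dist_eq, hf.dist_eq, h.dist_left], by rw [hf.dist_eq, hf.dist_eq, h.dist_right]⟩

lemma IsGeodesicSegment.isMidpoint {σ : ℝ → X} (hσ : IsGeodesicSegment σ x y) {s t : ℝ}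
    (hs : s ∈ Set.Icc 0 (dist x y)) (ht : t ∈ Set.Icc 0 (dist x y)) :
    IsMidpoint (σ ((s + t) / 2)) (σ s) (σ t) := by
  have hm : (s + t) / 2 ∈ Set.Icc 0 (dist x y) :=
    ⟨by linarith [hs.1, ht.1], by linarith [hs.2, ht.2]⟩
  constructor
  · rw [hσ.isometric _ hs _ hm, hσ.isometric _ hs _ ht,
      show s - (s + t) / 2 = (s - t) / 2 by ring, abs_div, abs_two]
  · rw [hσ.isometric _ ht _ hm, hσ.isometric _ hs _ ht,
      show t - (s + t) / 2 = -((s - t) / 2) by ring, abs_neg, abs_div, abs_two]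

lemma IsGeodesicSegment.isMidpoint_half {σ : ℝ → X} (hσ : IsGeodesicSegment σ x y) :
    IsMidpoint (σ (dist x y / 2)) x y := by
  have := hσ.isMidpoint (s := 0) (t := dist x y) ⟨le_rfl, dist_nonneg⟩ ⟨dist_nonneg, le_rfl⟩
  rwa [hσ.source, hσ.target, zero_add] at this

lemma sq_dist_le_two_mul_add (x y m : X) :
    dist x y ^ 2 ≤ 2 * (dist x m ^ 2 + dist y m ^ 2) := calc
  dist x y ^ 2 ≤ (dist x m + dist y m) ^ 2 := by
    have := dist_triangle_right x y m
    gcongr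
  _ ≤ 2 * (dist x m ^ 2 + dist y m ^ 2) := add_sq_le

lemma isMidpoint_of_sq_add_sq_le (h : 2 * (dist x m ^ 2 + dist y m ^ 2) ≤ dist x y ^ 2) :
    IsMidpoint m x y := by
  have hsum : dist x y ≤ dist x m + dist y m := dist_triangle_right x y m
  have heq : dist x m = dist y m := by
    have : (dist x m - dist y m) ^ 2 ≤ 0 := by
      nlinarith [dist_nonneg (x := x) (y := y)]
    nlinarith
  have hle : 2 * dist x m ≤ dist x y :=
    abs_le_of_sq_le_sq' (by rw [← heq] at h; linarith) dist_nonneg |>.2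
  exact ⟨by linarith, by linarith⟩

/-- Closure under metric midpoints, the form of convexity used throughout. -/
def MidpointConvex (A : Set X) : Prop :=
  ∀ ⦃x⦄, x ∈ A → ∀ ⦃y⦄, y ∈ A → ∀ ⦃m⦄, IsMidpoint m x y → m ∈ A

lemma MidpointConvex.preimage (hA : MidpointConvex A) {f : Y → X} (hf : Isometry f) :
    MidpointConvex (f ⁻¹' A) :=
  fun _ hx _ hy _ hm => hA hx hy (hm.map hf)

lemma IsGeodesicSegment.continuousOn {σ : ℝ → X} (hσ : IsGeodesicSegment σ x y) :
    ContinuousOn σ (Set.Icc 0 (dist x y)) :=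
  (LipschitzOnWith.of_dist_le_mul (K := 1) fun s hs t ht => by
    rw [hσ.isometric s hs t ht, NNReal.coe_one, one_mul, Real.dist_eq]).continuousOn

/-- A parameter `t` whose point lies outside `A` sits in a maximal open gap `(a, b)` of the
parameters of points of `A`; but `(a + b) / 2` is such a parameter too. -/
lemma MidpointConvex.isConvex (hA : MidpointConvex A) (hc : IsClosed A) : IsConvex A := by
  intro x hx y hy σ hσ t ht
  let S : Set ℝ := Set.Icc 0 (dist x y) ∩ σ ⁻¹' A
  have hS : IsCompact S := isCompact_Icc.of_isClosed_subset
    (hσ.continuousOn.preimage_isClosed_of_isClosed isClosed_Icc hc) Set.inter_subset_left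
  have h0 : (0 : ℝ) ∈ S ∩ Set.Iic t :=
    ⟨⟨⟨le_rfl, dist_nonneg⟩, by rwa [Set.mem_preimage, hσ.source]⟩, ht.1⟩
  have h1 : dist x y ∈ S ∩ Set.Ici t :=
    ⟨⟨⟨dist_nonneg, le_rfl⟩, by rwa [Set.mem_preimage, hσ.target]⟩, ht.2⟩
  obtain ⟨a, ⟨haS, hat : a ≤ t⟩, ha⟩ := (hS.inter_right isClosed_Iic).exists_isGreatest ⟨_, h0⟩
  obtain ⟨b, ⟨hbS, hbt : t ≤ b⟩, hb⟩ := (hS.inter_right isClosed_Ici).exists_isLeast ⟨_, h1⟩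
  have hm : (a + b) / 2 ∈ S :=
    ⟨⟨by linarith [haS.1.1, hbS.1.1], by linarith [haS.1.2, hbS.1.2]⟩,
      hA haS.2 hbS.2 (hσ.isMidpoint haS.1 hbS.1)⟩
  rcases le_total ((a + b) / 2) t with h | h
  · have : t = a := by linarith [ha ⟨hm, h⟩]
    exact this ▸ haS.2
  · have : t = b := by linarith [hb ⟨hm, h⟩]
    exact this ▸ hbS.2

/-- The sets onto which one projects: non-empty, closed and midpoint convex. -/
structure IsClosedConvex (A : Set X) : Prop where
  nonempty : A.Nonempty
  isClosed : IsClosed A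
  midpointConvex : MidpointConvex A

lemma IsClosedConvex.isConvex (hA : IsClosedConvex A) : IsConvex A :=
  hA.midpointConvex.isConvex hA.isClosed

end Midpoints

section Comparison

variable {X : Type*} [MetricSpace X] {A : Set X} {m x y : X}

namespace IsCATZero

variable (hX : IsCATZero X)
include hX

lemma exists_isMidpoint (x y : X) : ∃ m, IsMidpoint m x y :=
  let ⟨_, hσ⟩ := hX.geodesic x y
  ⟨_, hσ.isMidpoint_half⟩

lemma bruhat_tits_of_isGeodesicSegment {σ : ℝ → X} (hσ : IsGeodesicSegment σ x y) (z : X) :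
    2 * dist z (σ (dist x y / 2)) ^ 2 ≤ dist z x ^ 2 + dist z y ^ 2 - dist x y ^ 2 / 2 := by
  have := hX.bruhat_tits z x y σ hσ
  rw [dist_comm z x, dist_comm z y, dist_comm z, dist_comm x y]
  rw [dist_comm x y] at this
  linarith

lemma eq_of_isMidpoint {σ : ℝ → X} (hσ : IsGeodesicSegment σ x y) (hm : IsMidpoint m x y) :
    σ (dist x y / 2) = m := by
  have := hX.bruhat_tits_of_isGeodesicSegment hσ m
  rw [dist_comm m x, dist_comm m y, hm.dist_left, hm.dist_right] at this
  have : dist m (σ (dist x y / 2)) ^ 2 ≤ 0 := by linarith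
  exact (dist_eq_zero.1 (sq_nonpos_iff _ |>.1 this)).symm

lemma isMidpoint_unique {m' : X} (h : IsMidpoint m x y) (h' : IsMidpoint m' x y) : m = m' := by
  obtain ⟨σ, hσ⟩ := hX.geodesic x y
  rw [← hX.eq_of_isMidpoint hσ h, ← hX.eq_of_isMidpoint hσ h']

lemma bruhat_tits_isMidpoint (hm : IsMidpoint m x y) (z : X) :
    2 * dist z m ^ 2 ≤ dist z x ^ 2 + dist z y ^ 2 - dist x y ^ 2 / 2 := by
  obtain ⟨σ, hσ⟩ := hX.geodesic x y
  exact hX.eq_of_isMidpoint hσ hm ▸ hX.bruhat_tits_of_isGeodesicSegment hσ z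

lemma quadrilateral (a b c d : X) :
    dist a c ^ 2 + dist b d ^ 2 ≤ dist a b ^ 2 + dist b c ^ 2 + dist c d ^ 2 + dist a d ^ 2 := by
  obtain ⟨m, hm⟩ := hX.exists_isMidpoint a c
  have hb := hX.bruhat_tits_isMidpoint hm b
  have hd := hX.bruhat_tits_isMidpoint hm d
  rw [dist_comm b a] at hb
  rw [dist_comm d a, dist_comm d c] at hd
  linarith [sq_dist_le_two_mul_add b d m]

lemma dist_isMidpoint_le_of_common_left {m m' a b c : X} (h : IsMidpoint m a b)
    (h' : IsMidpoint m' a c) : dist m m' ≤ dist b c / 2 := by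
  have h1 := hX.bruhat_tits_isMidpoint h c
  have h2 := hX.bruhat_tits_isMidpoint h' m
  rw [dist_comm m a, h.dist_left, dist_comm m c] at h2
  rw [dist_comm c a, dist_comm c b] at h1
  exact abs_le_of_sq_le_sq' (by linarith) (by positivity) |>.2

lemma dist_isMidpoint_le {m m' a b c d : X} (h : IsMidpoint m a b) (h' : IsMidpoint m' c d) :
    dist m m' ≤ (dist a c + dist b d) / 2 := by
  obtain ⟨n, hn⟩ := hX.exists_isMidpoint a d
  have h1 := hX.dist_isMidpoint_le_of_common_left h hn
  have h2 := hX.dist_isMidpoint_le_of_common_left hn.symm h'.symm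
  linarith [dist_triangle m n m']

lemma subtype (hA : IsConvex A) : IsCATZero A where
  geodesic x y := by
    obtain ⟨σ, hσ⟩ := hX.geodesic x y
    have hmem : ∀ t ∈ Set.Icc 0 (dist x y), σ t ∈ A := hA x x.2 y y.2 σ hσ
    have h0 : (0 : ℝ) ∈ Set.Icc 0 (dist x y) := ⟨le_rfl, dist_nonneg⟩
    have h1 : dist x y ∈ Set.Icc 0 (dist x y) := ⟨dist_nonneg, le_rfl⟩
    refine ⟨Set.IccExtend h0.2 fun t => ⟨σ t, hmem t t.2⟩, fun s hs t ht => ?_, ?_, ?_⟩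
    · rw [Set.IccExtend_of_mem _ _ hs, Set.IccExtend_of_mem _ _ ht]
      exact hσ.isometric s hs t ht
    · rw [Set.IccExtend_of_mem _ _ h0]
      exact Subtype.ext hσ.source
    · rw [Set.IccExtend_of_mem _ _ h1]
      exact Subtype.ext hσ.target
  bruhat_tits z x y σ hσ := hX.bruhat_tits z x y (fun t => σ t) ⟨hσ.isometric,
    congrArg Subtype.val hσ.source, congrArg Subtype.val hσ.target⟩

end IsCATZero

end Comparison

section Projection

variable {X Y : Type*} [MetricSpace X] [MetricSpace Y] {A : Set X} {m p q x y z : X}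

/-- `p` is a point of `A` nearest to `x`. -/
structure IsNearestPoint (A : Set X) (x p : X) : Prop where
  mem : p ∈ A
  dist_eq : dist x p = Metric.infDist x A

lemma IsNearestPoint.dist_le (hp : IsNearestPoint A x p) (hz : z ∈ A) : dist x p ≤ dist x z :=
  hp.dist_eq ▸ Metric.infDist_le_dist_of_mem hz

lemma isNearestPoint_self (hx : x ∈ A) : IsNearestPoint A x x :=
  ⟨hx, by rw [dist_self, Metric.infDist_zero_of_mem hx]⟩

lemma IsNearestPoint.image {f : X → Y} (hf : Isometry f) (hp : IsNearestPoint A x p) :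
    IsNearestPoint (f '' A) (f x) (f p) :=
  ⟨Set.mem_image_of_mem f hp.mem, by rw [hf.dist_eq, Metric.infDist_image hf, hp.dist_eq]⟩

lemma IsNearestPoint.isMidpoint (hp : IsNearestPoint A x p) (hm : IsMidpoint m x p) :
    IsNearestPoint A m p := by
  refine ⟨hp.mem, le_antisymm ?_ (Metric.infDist_le_dist_of_mem hp.mem)⟩
  have := Metric.infDist_le_infDist_add_dist (s := A) (x := x) (y := m)
  rw [dist_comm m p, hm.dist_right]
  linarith [hm.dist_left, hp.dist_eq]

/-- The nearest point projection onto `A`. It is only meaningful where a nearest point exists. -/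
noncomputable def proj (A : Set X) (x : X) : X :=
  have : Nonempty X := ⟨x⟩
  Classical.epsilon (IsNearestPoint A x)

lemma exists_mem_ball_ciSup {ι : Type*} [Nonempty ι] {f : ι → ℝ} (hf : BddAbove (Set.range f))
    {δ : ℝ} (hδ : 0 < δ) : ∃ i, f i ∈ Metric.ball (⨆ i, f i) δ := by
  obtain ⟨i, hi⟩ := exists_lt_of_lt_ciSup (sub_lt_self (⨆ i, f i) hδ)
  rw [Real.ball_eq_Ioo]
  exact ⟨i, hi, (le_ciSup hf i).trans_lt (lt_add_of_pos_right _ hδ)⟩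

open Filter Topology in
lemma neBot_iInf_principal_inf_comap_dist {ι : Type*} [Nonempty ι] {C : ι → Set X}
    (hC : ∀ i, (C i).Nonempty) (hdir : Directed (· ⊇ ·) C) (x : X)
    (hbdd : BddAbove (Set.range fun i => Metric.infDist x (C i))) :
    ((⨅ i, 𝓟 (C i)) ⊓ comap (dist x) (𝓝 (⨆ i, Metric.infDist x (C i)))).NeBot := by
  refine ((hasBasis_iInf_principal hdir).inf (Metric.nhds_basis_ball.comap _)).neBot_iff.2 ?_
  rintro ⟨i, δ⟩ ⟨-, hδ⟩
  obtain ⟨j, hj⟩ := exists_mem_ball_ciSup hbdd hδ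
  obtain ⟨k, hki, hkj⟩ := hdir i j
  rw [Real.ball_eq_Ioo] at hj
  obtain ⟨y, hy, hxy⟩ := (Metric.infDist_lt_iff (hC k)).1
    ((le_ciSup hbdd k).trans_lt (lt_add_of_pos_right _ hδ))
  refine ⟨y, hki hy, ?_⟩
  rw [Set.mem_preimage, Real.ball_eq_Ioo]
  exact ⟨hj.1.trans_le (Metric.infDist_le_dist_of_mem (hkj hy)), hxy⟩

namespace IsCATZero

variable (hX : IsCATZero X)
include hX

lemma sq_dist_le_of_mem_of_mem (hA : MidpointConvex A) (x : X) (hy : y ∈ A) (hz : z ∈ A) :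
    dist y z ^ 2 ≤ 2 * (dist x y ^ 2 + dist x z ^ 2) - 4 * Metric.infDist x A ^ 2 := by
  obtain ⟨m, hm⟩ := hX.exists_isMidpoint y z
  have : Metric.infDist x A ^ 2 ≤ dist x m ^ 2 := by
    have := Metric.infDist_le_dist_of_mem (x := x) (hA hy hz hm)
    gcongr
    exact Metric.infDist_nonneg
  linarith [hX.bruhat_tits_isMidpoint hm x]

open Filter Topology in
/-- The weak compactness of bounded closed convex sets. The points of the `C i` whose distance to
`x` is close to the supremum `s` form a Cauchy filter, by the parallelogram inequality. -/
lemma exists_forall_mem_dist_eq [CompleteSpace X] {ι : Type*} [Nonempty ι] {C : ι → Set X}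
    (hC : ∀ i, IsClosedConvex (C i)) (hdir : Directed (· ⊇ ·) C) (x : X)
    (hbdd : BddAbove (Set.range fun i => Metric.infDist x (C i))) :
    ∃ p, (∀ i, p ∈ C i) ∧ dist x p = ⨆ i, Metric.infDist x (C i) := by
  set s := ⨆ i, Metric.infDist x (C i)
  let F : Filter X := (⨅ i, 𝓟 (C i)) ⊓ comap (dist x) (𝓝 s)
  have hmem (i : ι) : C i ∈ F := mem_inf_of_left (mem_iInf_of_mem i (mem_principal_self _))
  have hdist : Tendsto (dist x) F (𝓝 s) := tendsto_comap.mono_left inf_le_right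
  have hcauchy : Cauchy F := by
    refine Metric.cauchy_iff.2 ⟨neBot_iInf_principal_inf_comap_dist (fun i => (hC i).nonempty)
      hdir x hbdd, fun ε hε => ?_⟩
    obtain ⟨δ, hδ, hsq⟩ := Metric.continuous_iff.1 (continuous_pow (M := ℝ) 2) s (ε ^ 2 / 8)
      (by positivity)
    obtain ⟨i, hi⟩ := exists_mem_ball_ciSup hbdd hδ
    refine ⟨_, inter_mem (hmem i) (hdist (Metric.ball_mem_nhds s hδ)), fun y hy z hz => ?_⟩
    have hd := hX.sq_dist_le_of_mem_of_mem (hC i).midpointConvex x hy.1 hz.1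
    have hi' := (abs_lt.1 (hsq _ hi)).1
    have hy' := (abs_lt.1 (hsq _ hy.2)).2
    have hz' := (abs_lt.1 (hsq _ hz.2)).2
    exact lt_of_pow_lt_pow_left₀ 2 hε.le (by linarith)
  obtain ⟨p, hp : Tendsto id F (𝓝 p)⟩ := CompleteSpace.complete hcauchy
  have := hcauchy.1
  exact ⟨p, fun i => (hC i).isClosed.mem_of_tendsto hp (hmem i),
    tendsto_nhds_unique (tendsto_const_nhds.dist hp) hdist⟩

lemma isNearestPoint_proj [CompleteSpace X] (hA : IsClosedConvex A) (x : X) :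
    IsNearestPoint A x (proj A x) := by
  refine Classical.epsilon_spec (p := IsNearestPoint A x) ?_
  obtain ⟨p, hp, hdist⟩ := hX.exists_forall_mem_dist_eq (ι := Unit) (fun _ => hA)
    (directed_of_isDirected_le fun _ _ _ => subset_rfl) x (Set.finite_range _).bddAbove
  exact ⟨p, hp (), by rwa [ciSup_const] at hdist⟩

lemma proj_mem [CompleteSpace X] (hA : IsClosedConvex A) (x : X) : proj A x ∈ A :=
  (hX.isNearestPoint_proj hA x).mem

lemma dist_proj [CompleteSpace X] (hA : IsClosedConvex A) (x : X) :
    dist x (proj A x) = Metric.infDist x A :=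
  (hX.isNearestPoint_proj hA x).dist_eq

/-- Bisecting towards `p` gives the inequality with the factor `1 - 2⁻ᵏ` in front of
`dist p z ^ 2`, for every `k`. -/
lemma sq_dist_add_sq_dist_le (hA : MidpointConvex A) (hp : IsNearestPoint A x p) (hz : z ∈ A) :
    dist x p ^ 2 + dist p z ^ 2 ≤ dist x z ^ 2 := by
  have key (k : ℕ) :
      ∀ z ∈ A, dist x p ^ 2 + (1 - (1 / 2 : ℝ) ^ k) * dist p z ^ 2 ≤ dist x z ^ 2 := by
    induction k with
    | zero =>
      intro z hz
      rw [pow_zero, sub_self, zero_mul, add_zero]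
      have := hp.dist_le hz
      gcongr
    | succ k ih =>
      intro z hz
      obtain ⟨m, hm⟩ := hX.exists_isMidpoint p z
      have h1 := ih m (hA hp.mem hz hm)
      have h2 := hX.bruhat_tits_isMidpoint hm x
      rw [hm.dist_left] at h1
      rw [pow_succ (1 / 2 : ℝ)]
      linarith
  have hlim : Filter.Tendsto
      (fun k : ℕ => dist x p ^ 2 + (1 - (1 / 2 : ℝ) ^ k) * dist p z ^ 2) Filter.atTop
      (nhds (dist x p ^ 2 + (1 - 0) * dist p z ^ 2)) :=
    ((tendsto_const_nhds.sub (tendsto_pow_atTop_nhds_zero_of_lt_one (by norm_num)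
      (by norm_num))).mul_const _).const_add _
  simpa using le_of_tendsto' hlim fun k => key k z hz

lemma isNearestPoint_unique (hA : MidpointConvex A) (hp : IsNearestPoint A x p)
    (hq : IsNearestPoint A x q) : p = q := by
  have h := hX.sq_dist_add_sq_dist_le hA hp hq.mem
  rw [hp.dist_eq, hq.dist_eq] at h
  exact dist_eq_zero.1 (sq_nonpos_iff _ |>.1 (by linarith))

variable [CompleteSpace X]

lemma proj_eq (hA : IsClosedConvex A) (hp : IsNearestPoint A x p) : proj A x = p :=
  hX.isNearestPoint_unique hA.midpointConvex (hX.isNearestPoint_proj hA x) hp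

lemma proj_eq_self (hA : IsClosedConvex A) (hx : x ∈ A) : proj A x = x :=
  hX.proj_eq hA (isNearestPoint_self hx)

lemma dist_proj_proj_le (hA : IsClosedConvex A) (x y : X) :
    dist (proj A x) (proj A y) ≤ dist x y := by
  have h1 := hX.sq_dist_add_sq_dist_le hA.midpointConvex (hX.isNearestPoint_proj hA x)
    (hX.proj_mem hA y)
  have h2 := hX.sq_dist_add_sq_dist_le hA.midpointConvex (hX.isNearestPoint_proj hA y)
    (hX.proj_mem hA x)
  have h3 := hX.quadrilateral x (proj A x) (proj A y) y
  rw [dist_comm (proj A y) (proj A x), dist_comm y (proj A x)] at h2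
  rw [dist_comm (proj A y) y] at h3
  exact abs_le_of_sq_le_sq' (by linarith) dist_nonneg |>.2

lemma continuous_proj (hA : IsClosedConvex A) : Continuous (proj A) :=
  (LipschitzWith.of_dist_le' (K := 1) fun x y => by
    rw [one_mul]
    exact hX.dist_proj_proj_le hA x y).continuous

lemma infDist_isMidpoint_le_max (hA : IsClosedConvex A) (hm : IsMidpoint m x y) :
    Metric.infDist m A ≤ max (Metric.infDist x A) (Metric.infDist y A) := by
  obtain ⟨n, hn⟩ := hX.exists_isMidpoint (proj A x) (proj A y)
  have hmn := hX.dist_isMidpoint_le hm hn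
  rw [hX.dist_proj hA, hX.dist_proj hA] at hmn
  calc
    Metric.infDist m A ≤ dist m n :=
      Metric.infDist_le_dist_of_mem (hA.midpointConvex (hX.proj_mem hA x) (hX.proj_mem hA y) hn)
    _ ≤ (Metric.infDist x A + Metric.infDist y A) / 2 := hmn
    _ ≤ max (Metric.infDist x A) (Metric.infDist y A) := by
      linarith [le_max_left (Metric.infDist x A) (Metric.infDist y A),
        le_max_right (Metric.infDist x A) (Metric.infDist y A)]

end IsCATZero

end Projection

section Displacement

variable {G : Type*} [Group G] {X : Type*} [MetricSpace X] [MulAction G X]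

variable (G) in
/-- Every element of `G` moves the points of `S` by a bounded amount, with a bound that may depend
on the element. -/
def HasBoundedDisplacement (S : Set X) : Prop :=
  ∀ g : G, ∃ B : ℝ, ∀ x ∈ S, dist (g • x) x ≤ B

variable (G X) in
/-- Monod's *evanescent* actions: `G` moves the points of some unbounded set by bounded amounts. -/
def IsEvanescent : Prop :=
  ∃ S : Set X, HasBoundedDisplacement G S ∧ ¬Bornology.IsBounded S

variable [IsIsometricSMul G X]

lemma isClosed_setOf_dist_smul_le (g : G) (B : ℝ) : IsClosed {x : X | dist (g • x) x ≤ B} :=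
  isClosed_le ((isometry_smul X g).continuous.dist continuous_id) continuous_const

lemma IsCATZero.midpointConvex_setOf_dist_smul_le (hX : IsCATZero X) (g : G) (B : ℝ) :
    MidpointConvex {x : X | dist (g • x) x ≤ B} := by
  intro x hx y hy m hm
  rw [Set.mem_ofPred_eq] at hx hy ⊢
  linarith [hX.dist_isMidpoint_le (hm.map (isometry_smul X g)) hm]

lemma IsCATZero.dist_smul_geodesic_le (hX : IsCATZero X) {σ : ℝ → X} {x y : X}
    (hσ : IsGeodesicSegment σ x y) {t : ℝ} (ht : t ∈ Set.Icc 0 (dist x y)) (g : G) :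
    dist (g • σ t) (σ t) ≤ max (dist (g • x) x) (dist (g • y) y) :=
  Set.mem_ofPred.1 <| (hX.midpointConvex_setOf_dist_smul_le g _).isConvex
    (isClosed_setOf_dist_smul_le g _) x (Set.mem_ofPred.2 (le_max_left _ _)) y
    (Set.mem_ofPred.2 (le_max_right _ _)) σ hσ t ht

end Displacement

section Boundary

open Filter Topology

variable {X : Type*} [MetricSpace X] [ProperSpace X]

/-- Geodesic segments issuing from `x₀` whose lengths tend to infinity along an ultrafilter converge
along it to a geodesic ray, since their points at time `t` stay in a compact ball. -/
lemma exists_isometry_tendsto_geodesic {ι : Type*} (l : Ultrafilter ι) {x₀ : X} {x : ι → X}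
    (hx : Tendsto (fun k => dist x₀ (x k)) l atTop) {σ : ι → ℝ → X}
    (hσ : ∀ k, IsGeodesicSegment (σ k) x₀ (x k)) :
    ∃ r : ℝ≥0 → X, Isometry r ∧ ∀ t : ℝ≥0, Tendsto (fun k => σ k t) l (𝓝 (r t)) := by
  have hmem (t : ℝ≥0) : ∀ᶠ k in l, (t : ℝ) ∈ Set.Icc 0 (dist x₀ (x k)) := by
    filter_upwards [hx.eventually_ge_atTop (t : ℝ)] with k hk
    exact ⟨t.coe_nonneg, hk⟩
  have hlim (t : ℝ≥0) : ∃ y, Tendsto (fun k => σ k t) l (𝓝 y) := by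
    have hball : ∀ᶠ k in l, σ k t ∈ Metric.closedBall x₀ (t : ℝ) := by
      filter_upwards [hmem t] with k hk
      rw [Metric.mem_closedBall, ← (hσ k).source,
        (hσ k).isometric _ hk _ ⟨le_rfl, dist_nonneg⟩, sub_zero, abs_of_nonneg t.coe_nonneg]
    obtain ⟨y, -, hy⟩ := (isCompact_closedBall x₀ (t : ℝ)).ultrafilter_le_nhds
      (l.map fun k => σ k t) (le_principal_iff.2 hball)
    exact ⟨y, hy⟩
  choose r hr using hlim
  refine ⟨r, Isometry.of_dist_eq fun s t => tendsto_nhds_unique ((hr s).dist (hr t)) ?_, hr⟩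
  refine tendsto_const_nhds.congr' ?_
  filter_upwards [hmem s, hmem t] with k hs ht
  rw [(hσ k).isometric _ hs _ ht, NNReal.dist_eq]

lemma IsCATZero.exists_fixedPoint_of_isEvanescent (hX : IsCATZero X) {G : Type*} [Group G]
    [MulAction G X] [IsIsometricSMul G X] (hG : IsEvanescent G X) :
    ∃ ξ : Boundary X, ∀ g : G, g • ξ = ξ := by
  obtain ⟨S, hS, hunb⟩ := hG
  obtain ⟨x₀, -⟩ := Set.nonempty_iff_ne_empty.2 fun h : S = ∅ =>
    hunb (h ▸ Bornology.isBounded_empty)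
  have : (𝓟 S ⊓ Bornology.cobounded X).NeBot := neBot_iff.2 fun h => hunb <|
    let ⟨_, _, hb⟩ := (hasBasis_principal S).disjoint_cobounded_iff.1 (disjoint_iff.2 h)
    hb
  let l := Ultrafilter.of (𝓟 S ⊓ Bornology.cobounded X)
  have hl : (l : Filter X) ≤ 𝓟 S ⊓ Bornology.cobounded X := Ultrafilter.of_le _
  choose σ hσ using hX.geodesic x₀
  have hfar : Tendsto (fun x => dist x₀ x) l atTop :=
    (Metric.tendsto_dist_left_cobounded_atTop x₀).mono_left (hl.trans inf_le_right)
  obtain ⟨r, hr, hlim⟩ := exists_isometry_tendsto_geodesic l hfar hσ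
  refine ⟨Quotient.mk (asymptotic X) ⟨r, hr⟩, fun g => Quotient.sound ?_⟩
  obtain ⟨B, hB⟩ := hS g
  refine ⟨max (dist (g • x₀) x₀) B, fun t => ?_⟩
  change dist (g • r t) (r t) ≤ _
  refine le_of_tendsto (((hlim t).const_smul g).dist (hlim t)) ?_
  filter_upwards [hfar.eventually_ge_atTop (t : ℝ), hl (mem_inf_of_left (mem_principal_self S))]
    with x hx hxS
  exact (hX.dist_smul_geodesic_le (hσ x) ⟨t.coe_nonneg, hx⟩ g).trans (max_le_max le_rfl (hB x hxS))

end Boundary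

section Invariant

variable {H : Type*} [Group H] {X Y : Type*} [MulAction H X] [MulAction H Y]

/-- The range of an equivariant map, as an invariant subset. -/
def equivariantRange (f : Y →[H] X) : SubMulAction H X where
  carrier := Set.range f
  smul_mem' := by
    rintro h _ ⟨y, rfl⟩
    exact ⟨h • y, map_smul f h y⟩

variable [MetricSpace X] [MetricSpace Y]

instance isIsometricSMul_subMulAction [IsIsometricSMul H X] (C : SubMulAction H X) :
    IsIsometricSMul H C :=
  ⟨fun h x y => edist_smul_left h (x : X) (y : X)⟩

lemma isClosedConvex_sInf {S : Set (SubMulAction H X)}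
    (hS : ∀ D ∈ S, IsClosedConvex (D : Set X))
    (hne : ((sInf S : SubMulAction H X) : Set X).Nonempty) :
    IsClosedConvex ((sInf S : SubMulAction H X) : Set X) where
  nonempty := hne
  isClosed := isClosed_biInter fun D hD => (hS D hD).isClosed
  midpointConvex _ hx _ hy _ hm := Set.mem_iInter₂.2 fun D hD =>
    (hS D hD).midpointConvex (Set.mem_iInter₂.1 hx D hD) (Set.mem_iInter₂.1 hy D hD) hm

lemma IsCATZero.isClosedConvex_range (hX : IsCATZero X) [CompleteSpace Y] [Nonempty Y]
    (hY : ∀ a b : Y, ∃ m, IsMidpoint m a b) {f : Y → X} (hf : Isometry f) :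
    IsClosedConvex (Set.range f) where
  nonempty := Set.range_nonempty f
  isClosed := hf.isClosedEmbedding.isClosed_range
  midpointConvex := by
    rintro _ ⟨a, rfl⟩ _ ⟨b, rfl⟩ m hm
    obtain ⟨n, hn⟩ := hY a b
    exact ⟨n, hX.isMidpoint_unique (hn.map hf) hm⟩

end Invariant

section Minimal

variable {H : Type*} [Group H] {X : Type*} [MetricSpace X] [MulAction H X]
  {C D : SubMulAction H X} {x y : X}

/-- Minimality among the non-empty closed convex `H`-invariant subsets of `X`. -/
abbrev IsMinimalConvex (C : SubMulAction H X) : Prop :=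
  Minimal (fun D : SubMulAction H X => IsClosedConvex (D : Set X)) C

variable (H) in
/-- The closed convex `H`-hull of a point: the smallest non-empty closed convex `H`-invariant set
containing it. On the union of the minimal sets it is the minimal set through the point. -/
def leaf (z : X) : SubMulAction H X :=
  sInf {D | IsClosedConvex (D : Set X) ∧ z ∈ D}

lemma mem_leaf (z : X) : z ∈ leaf H z :=
  Set.mem_iInter₂.2 fun _ hD => hD.2

lemma isClosedConvex_leaf (z : X) : IsClosedConvex (leaf H z : Set X) :=
  isClosedConvex_sInf (fun _ hD => hD.1) ⟨z, mem_leaf z⟩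

lemma IsMinimalConvex.leaf_eq (hC : IsMinimalConvex C) (hx : x ∈ C) : leaf H x = C :=
  hC.eq_of_le (isClosedConvex_leaf x) (sInf_le ⟨hC.prop, hx⟩)

variable (hX : IsCATZero X) [CompleteSpace X]
include hX

lemma IsMinimalConvex.eq_top_of_isClosedConvex (hC : IsMinimalConvex C) {D : SubMulAction H C}
    (hD : IsClosedConvex (D : Set C)) : D = ⊤ := by
  have : CompleteSpace C := hC.prop.isClosed.completeSpace_coe
  have : CompleteSpace D := hD.isClosed.completeSpace_coe
  have : Nonempty D := hD.nonempty.to_subtype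
  let f : D →[H] X := C.subtype.comp D.subtype
  have hf : IsClosedConvex (equivariantRange f : Set X) := hX.isClosedConvex_range
    ((hX.subtype hC.prop.isConvex).subtype hD.isConvex).exists_isMidpoint
    (isometry_subtype_coe.comp isometry_subtype_coe)
  have hle : C ≤ equivariantRange f := hC.le_of_le hf <| by
    rintro _ ⟨x, rfl⟩
    exact x.1.2
  refine SubMulAction.ext fun x => ⟨fun _ => trivial, fun _ => ?_⟩
  obtain ⟨y, hy⟩ := hle x.2
  exact (Subtype.ext hy : y.1 = x) ▸ y.2

lemma IsMinimalConvex.equivariantRange (hC : IsMinimalConvex C) {f : C →[H] X} (hf : Isometry f) :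
    IsMinimalConvex (equivariantRange f) := by
  have : CompleteSpace C := hC.prop.isClosed.completeSpace_coe
  have : Nonempty C := hC.prop.nonempty.to_subtype
  refine ⟨hX.isClosedConvex_range (hX.subtype hC.prop.isConvex).exists_isMidpoint hf,
    fun D hD hDf => ?_⟩
  let E : SubMulAction H C :=
    { carrier := f ⁻¹' D
      smul_mem' := fun h x hx => by
        rw [Set.mem_preimage, map_smul]
        exact D.smul_mem h hx }
  have hE : E = ⊤ := hC.eq_top_of_isClosedConvex hX
    { nonempty := by
        obtain ⟨y, hy⟩ := hD.nonempty
        obtain ⟨x, rfl⟩ := hDf hy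
        exact ⟨x, hy⟩
      isClosed := hD.isClosed.preimage hf.continuous
      midpointConvex := hD.midpointConvex.preimage hf }
  rintro _ ⟨x, rfl⟩
  exact (hE ▸ trivial : x ∈ E)

lemma IsMinimalConvex.apply_eq_apply (hC : IsMinimalConvex C) {φ : C → ℝ} (hφ : Continuous φ)
    (hconv : ∀ x y m, IsMidpoint m x y → φ m ≤ max (φ x) (φ y))
    (hinv : ∀ (h : H) x, φ (h • x) = φ x) (x y : C) : φ x = φ y := by
  have key (x y : C) : φ y ≤ φ x := by
    let D : SubMulAction H C :=
      { carrier := {z | φ z ≤ φ x}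
        smul_mem' := fun h z hz => (hinv h z).trans_le hz }
    have hD : D = ⊤ := hC.eq_top_of_isClosedConvex hX
      { nonempty := ⟨x, le_refl (φ x)⟩
        isClosed := isClosed_le hφ continuous_const
        midpointConvex := fun a ha b hb m hm => (hconv a b m hm).trans (max_le ha hb) }
    exact (hD ▸ trivial : y ∈ D)
  exact le_antisymm (key y x) (key x y)

end Minimal

section Existence

variable {H : Type*} [Group H] {X : Type*} [MetricSpace X] [CompleteSpace X] [MulAction H X]
  [IsIsometricSMul H X] {C : SubMulAction H X} (hX : IsCATZero X)
include hX

lemma IsCATZero.proj_smul (hC : IsClosedConvex (C : Set X)) (h : H) (x : X) :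
    proj (C : Set X) (h • x) = h • proj (C : Set X) x := by
  have himage : (h • ·) '' (C : Set X) = C := by
    refine Set.Subset.antisymm (Set.image_subset_iff.2 fun x hx => C.smul_mem h hx) fun x hx => ?_
    exact ⟨h⁻¹ • x, C.smul_mem h⁻¹ hx, smul_inv_smul h x⟩
  have hnear := (hX.isNearestPoint_proj hC x).image (isometry_smul X h)
  rw [himage] at hnear
  exact hX.proj_eq hC hnear

variable (hb : ∀ S ⊆ (C : Set X), HasBoundedDisplacement H S → Bornology.IsBounded S)
  {c : Set (SubMulAction H X)} (hc : ∀ D ∈ c, IsClosedConvex (D : Set X) ∧ D ≤ C)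
include hb hc

lemma IsCATZero.bddAbove_infDist (x : X) :
    BddAbove (Set.range fun D : c => Metric.infDist x (D : SubMulAction H X)) := by
  have hproj : Bornology.IsBounded (Set.range fun D : c => proj (D : Set X) x) := by
    refine hb _ ?_ fun h => ⟨dist (h • x) x, ?_⟩
    · rintro _ ⟨D, rfl⟩
      exact (hc D D.2).2 (hX.proj_mem (hc D D.2).1 x)
    · rintro _ ⟨D, rfl⟩
      rw [← hX.proj_smul (hc D D.2).1]
      exact hX.dist_proj_proj_le (hc D D.2).1 _ _
  obtain ⟨R, hR⟩ := hproj.subset_closedBall x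
  refine ⟨R, ?_⟩
  rintro _ ⟨D, rfl⟩
  have hD : proj (D : Set X) x ∈ Metric.closedBall x R := hR ⟨D, rfl⟩
  rwa [Metric.mem_closedBall, dist_comm, hX.dist_proj (hc D D.2).1] at hD

lemma IsCATZero.isClosedConvex_sInf_of_isChain (hchain : IsChain (· ≤ ·) c) (hne : c.Nonempty) :
    IsClosedConvex ((sInf c : SubMulAction H X) : Set X) := by
  obtain ⟨D, hD⟩ := hne
  obtain ⟨x, -⟩ := (hc D hD).1.nonempty
  have : Nonempty c := ⟨D, hD⟩
  obtain ⟨p, hp, -⟩ := hX.exists_forall_mem_dist_eq (fun D : c => (hc D D.2).1)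
    (fun D E => (hchain.total D.2 E.2).elim (fun h => ⟨D, subset_rfl, h⟩)
      fun h => ⟨E, h, subset_rfl⟩) x (hX.bddAbove_infDist hb hc x)
  exact isClosedConvex_sInf (fun D hD => (hc D hD).1) ⟨p, Set.mem_iInter₂.2 fun D hD => hp ⟨D, hD⟩⟩

omit hc in
lemma IsCATZero.exists_isMinimalConvex_le (hC : IsClosedConvex (C : Set X)) :
    ∃ D ≤ C, IsMinimalConvex D := by
  obtain ⟨D, hDC, hD⟩ := zorn_le_nonempty₀
    {D : (SubMulAction H X)ᵒᵈ | IsClosedConvex (D.ofDual : Set X) ∧ D.ofDual ≤ C}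
    (fun c hc hchain D hD => ⟨OrderDual.toDual (sInf (OrderDual.toDual ⁻¹' c)),
      ⟨hX.isClosedConvex_sInf_of_isChain hb hc hchain.symm ⟨_, hD⟩,
        (sInf_le (show D.ofDual ∈ OrderDual.toDual ⁻¹' c from hD)).trans (hc hD).2⟩,
      fun E hE => sInf_le (show E.ofDual ∈ OrderDual.toDual ⁻¹' c from hE)⟩)
    (OrderDual.toDual C) ⟨hC, le_rfl⟩
  exact ⟨D.ofDual, hDC, hD.prop.1, fun E hE hED => hD.le_of_ge ⟨hE, hED.trans hDC⟩ hED⟩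

omit hb hc in
lemma IsCATZero.exists_isMinimalConvex [Nonempty X] {K : Type*} [Group K] [MulAction K X]
    [IsIsometricSMul K X] [SMulCommClass H K X]
    (hb : ∀ S : Set X, HasBoundedDisplacement H S → HasBoundedDisplacement K S →
      Bornology.IsBounded S) :
    ∃ C : SubMulAction H X, IsMinimalConvex C := by
  obtain ⟨x₀⟩ := ‹Nonempty X›
  let C : SubMulAction H X :=
    { carrier := {x | ∀ k : K, dist (k • x) x ≤ dist (k • x₀) x₀}
      smul_mem' := fun h x hx k => by
        rw [← smul_comm, dist_smul]
        exact hx k }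
  have hC : IsClosedConvex (C : Set X) :=
    { nonempty := ⟨x₀, fun _ => le_rfl⟩
      isClosed := by
        have hclosed := isClosed_iInter fun k : K =>
          isClosed_setOf_dist_smul_le (X := X) k (dist (k • x₀) x₀)
        rwa [← Set.ofPred_forall] at hclosed
      midpointConvex := fun x hx y hy m hm k =>
        hX.midpointConvex_setOf_dist_smul_le k _ (hx k) (hy k) hm }
  obtain ⟨D, -, hD⟩ := hX.exists_isMinimalConvex_le (C := C)
    (fun S hS hH => hb S hH fun k => ⟨_, fun x hx => hS hx k⟩) hC
  exact ⟨D, hD⟩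

end Existence

section Parallel

variable {H : Type*} [Group H] {X : Type*} [MetricSpace X] [CompleteSpace X] [MulAction H X]
  [IsIsometricSMul H X] {C D : SubMulAction H X} {x y : X} (hX : IsCATZero X)
  (hC : IsMinimalConvex C)
include hX hC

lemma IsMinimalConvex.infDist_eq (hD : IsClosedConvex (D : Set X)) (hx : x ∈ C) (hy : y ∈ C) :
    Metric.infDist x D = Metric.infDist y D :=
  hC.apply_eq_apply hX (φ := fun z : C => Metric.infDist (z : X) D)
    ((Metric.continuous_infDist_pt _).comp continuous_subtype_val)
    (fun _ _ _ hm => hX.infDist_isMidpoint_le_max hD (hm.map isometry_subtype_coe))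
    (fun h z => by
      rw [SubMulAction.val_smul, ← hX.dist_proj hD, hX.proj_smul hD, dist_smul, hX.dist_proj hD])
    ⟨x, hx⟩ ⟨y, hy⟩

variable (hD : IsMinimalConvex D)
include hD

lemma IsMinimalConvex.infDist_le (hx : x ∈ C) (hy : y ∈ D) :
    Metric.infDist y C ≤ Metric.infDist x D := by
  rw [hD.infDist_eq hX hC.prop hy (hX.proj_mem hD.prop x), ← hX.dist_proj hD.prop, dist_comm]
  exact Metric.infDist_le_dist_of_mem hx

lemma IsMinimalConvex.infDist_comm (hx : x ∈ C) (hy : y ∈ D) :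
    Metric.infDist x D = Metric.infDist y C :=
  le_antisymm (hD.infDist_le hX hC hy hx) (hC.infDist_le hX hD hx hy)

lemma IsMinimalConvex.proj_proj (hx : x ∈ C) : proj (C : Set X) (proj (D : Set X) x) = x :=
  hX.proj_eq hC.prop ⟨hx, by
    rw [dist_comm, hX.dist_proj hD.prop, hC.infDist_comm hX hD hx (hX.proj_mem hD.prop x)]⟩

lemma IsMinimalConvex.dist_proj_proj (hx : x ∈ C) (hy : y ∈ C) :
    dist (proj (D : Set X) x) (proj (D : Set X) y) = dist x y := by
  refine le_antisymm (hX.dist_proj_proj_le hD.prop x y) ?_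
  have := hX.dist_proj_proj_le hC.prop (proj (D : Set X) x) (proj (D : Set X) y)
  rwa [hC.proj_proj hX hD hx, hC.proj_proj hX hD hy] at this

/-- The quadrilateral `x`, `proj D x`, `y`, `proj C y` is a flat rectangle: the two lower bounds
for its diagonals add up to the upper bound given by the quadrilateral inequality. -/
lemma IsMinimalConvex.sq_dist_eq (hx : x ∈ C) (hy : y ∈ D) :
    dist x y ^ 2 = dist (proj (D : Set X) x) y ^ 2 + Metric.infDist x D ^ 2 := by
  set x' := proj (D : Set X) x
  set y' := proj (C : Set X) y
  have hy' : y' ∈ C := hX.proj_mem hC.prop y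
  have hxx' : dist x x' = Metric.infDist x D := hX.dist_proj hD.prop x
  have hyy' : dist y y' = Metric.infDist x D :=
    (hX.dist_proj hC.prop y).trans (hC.infDist_comm hX hD hx hy).symm
  have hsides : dist x' y = dist x y' := by
    rw [← hC.dist_proj_proj hX hD hx hy', hD.proj_proj hX hC hy]
  have hdiag := hX.sq_dist_add_sq_dist_le hD.prop.midpointConvex
    (hX.isNearestPoint_proj hD.prop x) hy
  have hdiag' := hX.sq_dist_add_sq_dist_le hC.prop.midpointConvex
    (hX.isNearestPoint_proj hC.prop x') hy'
  rw [hC.proj_proj hX hD hx, dist_comm x' x] at hdiag'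
  have hquad := hX.quadrilateral x x' y y'
  rw [hxx', hyy'] at hquad
  rw [hxx'] at hdiag hdiag'
  rw [hsides] at hdiag hquad ⊢
  linarith

end Parallel

section Clifford

variable {X : Type*} [MetricSpace X]

lemma dist_iterate_le {f : X → X} {δ : ℝ} (hδ : ∀ x, dist x (f x) ≤ δ) (n : ℕ) (x : X) :
    dist x (f^[n] x) ≤ n * δ := by
  have := dist_le_range_sum_of_dist_le (f := fun k => f^[k] x) (d := fun _ => δ) n fun {k} _ => by
    rw [Function.iterate_succ_apply']
    exact hδ _
  rwa [Finset.sum_const, Finset.card_range, nsmul_eq_mul] at this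

lemma IsCATZero.dist_apply_apply (hX : IsCATZero X) {f : X → X} (hf : Isometry f) {δ : ℝ}
    (hδ : ∀ x, dist x (f x) = δ) (x : X) : dist x (f (f x)) = 2 * δ := by
  obtain ⟨m, hm⟩ := hX.exists_isMidpoint x (f x)
  have hle := hX.dist_isMidpoint_le_of_common_left hm.symm (hm.map hf)
  rw [hδ] at hle
  have hge := dist_triangle x (f x) (f (f x))
  rw [hδ, hδ] at hge
  linarith

lemma IsCATZero.dist_iterate_two_pow (hX : IsCATZero X) {f : X → X} (hf : Isometry f) {δ : ℝ}
    (hδ : ∀ x, dist x (f x) = δ) (j : ℕ) (x : X) : dist x (f^[2 ^ j] x) = 2 ^ j * δ := by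
  induction j generalizing f δ with
  | zero => rw [pow_zero, pow_zero, one_mul, Function.iterate_one, hδ]
  | succ j ih =>
    have hsq := ih (hf.comp hf) (hX.dist_apply_apply hf hδ)
    rw [pow_succ', Function.iterate_mul]
    rw [pow_succ, mul_assoc]
    exact hsq

lemma IsCATZero.dist_iterate (hX : IsCATZero X) {f : X → X} (hf : Isometry f) {δ : ℝ}
    (hδ : ∀ x, dist x (f x) = δ) (n : ℕ) (x : X) : dist x (f^[n] x) = n * δ := by
  obtain ⟨k, hk⟩ := exists_add_of_le (Nat.lt_two_pow_self (n := n)).le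
  have htotal := hX.dist_iterate_two_pow hf hδ n x
  have hfst := dist_iterate_le (fun y => (hδ y).le) n x
  have hsnd := dist_iterate_le (fun y => (hδ y).le) k (f^[n] x)
  have htri := dist_triangle x (f^[n] x) (f^[k] (f^[n] x))
  rw [← Function.iterate_add_apply, add_comm k n, ← hk] at hsnd htri
  have hcast : (2 : ℝ) ^ n = n + k := by exact_mod_cast hk
  rw [htotal, hcast] at htri
  linarith

variable {H : Type*} [Group H] [MulAction H X] [IsIsometricSMul H X] {C : SubMulAction H X}

lemma IsMinimalConvex.dist_apply_eq [CompleteSpace X] (hX : IsCATZero X) (hC : IsMinimalConvex C)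
    {f : C →[H] C} (hf : Isometry f) (x y : C) : dist x (f x) = dist y (f y) := by
  refine hC.apply_eq_apply hX (φ := fun y => dist y (f y)) (continuous_id.dist hf.continuous)
    (fun a b m hm => ?_) (fun h y => by rw [map_smul, dist_smul]) x y
  refine ((hX.subtype hC.prop.isConvex).dist_isMidpoint_le hm (hm.map hf)).trans ?_
  linarith [le_max_left (dist a (f a)) (dist b (f b)), le_max_right (dist a (f a)) (dist b (f b))]

lemma IsMinimalConvex.dist_iterate [CompleteSpace X] (hX : IsCATZero X) (hC : IsMinimalConvex C)
    {f : C →[H] C} (hf : Isometry f) (n : ℕ) (x : C) :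
    dist x (f^[n] x) = n * dist x (f x) :=
  (hX.subtype hC.prop.isConvex).dist_iterate hf (fun y => hC.dist_apply_eq hX hf y x) n x

end Clifford

section Holonomy

lemma nonpos_of_forall_nat_mul_le {a b : ℝ} (h : ∀ n : ℕ, n * a ≤ b) : a ≤ 0 := by
  by_contra! ha
  obtain ⟨n, hn⟩ := exists_nat_gt (b / a)
  exact (h n).not_gt ((div_lt_iff₀ ha).1 hn)

variable {H : Type*} [Group H] {X : Type*} [MetricSpace X] [CompleteSpace X] [MulAction H X]
  [IsIsometricSMul H X] {C₀ C₁ C₂ C D : SubMulAction H X} (hX : IsCATZero X)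

/-- The projection from `C` to `D` as an `H`-equivariant map. -/
noncomputable def projHom (hD : IsClosedConvex (D : Set X)) (C : SubMulAction H X) : C →[H] D where
  toFun x := ⟨proj (D : Set X) x, hX.proj_mem hD x⟩
  map_smul' h x := Subtype.ext (hX.proj_smul hD h x)

/-- The composite `C₀ → C₁ → C₂ → C₀` of the projections between three invariant sets. -/
noncomputable def holonomy (h₀ : IsClosedConvex (C₀ : Set X)) (h₁ : IsClosedConvex (C₁ : Set X))
    (h₂ : IsClosedConvex (C₂ : Set X)) : C₀ →[H] C₀ :=
  ((projHom hX h₀ C₂).comp (projHom hX h₂ C₁)).comp (projHom hX h₁ C₀)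

include hX

lemma IsMinimalConvex.isometry_projHom (hC : IsMinimalConvex C) (hD : IsMinimalConvex D) :
    Isometry (projHom hX hD.prop C) :=
  Isometry.of_dist_eq fun x y => hC.dist_proj_proj hX hD x.2 y.2

variable (h₀ : IsMinimalConvex C₀) (h₁ : IsMinimalConvex C₁) (h₂ : IsMinimalConvex C₂)
include h₀ h₁ h₂

lemma IsMinimalConvex.isometry_holonomy : Isometry (holonomy hX h₀.prop h₁.prop h₂.prop) :=
  ((h₂.isometry_projHom hX h₀).comp (h₁.isometry_projHom hX h₂)).comp (h₀.isometry_projHom hX h₁)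

/-- The holonomy `f` translates by a constant `δ`. Going from `f^[2 * n + 1] x ∈ C₀` to the
projection `u` of `x` to `C₁` costs at least `(2 * n + 1) * δ`; the detour through the point `z`
of `C₂` halfway is shorter than `2 * n * δ` plus a constant, even in the sense of squares. -/
lemma IsMinimalConvex.nat_mul_sq_dist_holonomy_le (x : C₀) (n : ℕ) :
    n * dist x (holonomy hX h₀.prop h₁.prop h₂.prop x) ^ 2 ≤
      2 * (Metric.infDist (projHom hX h₁.prop C₀ x : X) C₂ ^ 2 +
        Metric.infDist (projHom hX h₂.prop C₁ (projHom hX h₁.prop C₀ x) : X) C₀ ^ 2) := by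
  set f := holonomy hX h₀.prop h₁.prop h₂.prop
  have hf : Isometry f := h₀.isometry_holonomy hX h₁ h₂
  set δ := dist x (f x)
  have hδ (k : ℕ) (y : C₀) : dist y (f^[k] y) = k * δ := by
    rw [h₀.dist_iterate hX hf, h₀.dist_apply_eq hX hf y x]
  set u := projHom hX h₁.prop C₀ x
  let z : C₂ := projHom hX h₂.prop C₁ (projHom hX h₁.prop C₀ (f^[n] x))
  let z₀ : C₀ := projHom hX h₀.prop C₂ z
  let y : C₀ := f^[n] z₀
  have hyz : dist (y : X) z ^ 2 = (n * δ) ^ 2 +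
      Metric.infDist (projHom hX h₂.prop C₁ u : X) C₀ ^ 2 := by
    rw [dist_comm, h₂.sq_dist_eq hX h₀ z.2 y.2,
      h₂.infDist_eq hX h₀.prop z.2 (projHom hX h₂.prop C₁ u).2, ← hδ n z₀]
    rfl
  have huz : dist (u : X) z ^ 2 = (n * δ) ^ 2 + Metric.infDist (u : X) C₂ ^ 2 := by
    rw [h₁.sq_dist_eq hX h₂ u.2 z.2, ← hδ n x, ← (h₀.isometry_projHom hX h₁).dist_eq,
      ← (h₁.isometry_projHom hX h₂).dist_eq]
    rfl
  have hxy : dist x y = (2 * n + 1) * δ := by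
    have hz₀ : z₀ = f^[n + 1] x := (Function.iterate_succ_apply' f n x).symm
    have hy : y = f^[n + (n + 1)] x := by rw [Function.iterate_add_apply, ← hz₀]
    rw [hy, hδ]
    push_cast
    ring
  have hyu : ((2 * n + 1) * δ) ^ 2 ≤ dist (y : X) u ^ 2 := by
    rw [h₀.sq_dist_eq hX h₁ y.2 u.2, ← hxy, dist_comm,
      ← (h₀.isometry_projHom hX h₁).dist_eq]
    exact le_add_of_nonneg_right (sq_nonneg _)
  have hdetour := sq_dist_le_two_mul_add (y : X) u z
  rw [hyz, huz] at hdetour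
  nlinarith [mul_nonneg n.cast_nonneg (sq_nonneg δ), sq_nonneg δ]

lemma IsMinimalConvex.proj_proj_proj {x : X} (hx : x ∈ C₀) :
    proj (C₀ : Set X) (proj (C₂ : Set X) (proj (C₁ : Set X) x)) = x := by
  have hle := nonpos_of_forall_nat_mul_le (h₀.nat_mul_sq_dist_holonomy_le hX h₁ h₂ ⟨x, hx⟩)
  exact congrArg Subtype.val (dist_eq_zero.1 ((sq_nonpos_iff _).1 hle)).symm

lemma IsMinimalConvex.proj_comp_proj {x : X} (hx : x ∈ C₀) :
    proj (C₂ : Set X) (proj (C₁ : Set X) x) = proj (C₂ : Set X) x := by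
  rw [← h₂.proj_proj hX h₀ (hX.proj_mem h₂.prop (proj (C₁ : Set X) x)),
    h₀.proj_proj_proj hX h₁ h₂ hx]

end Holonomy

section MinimalUnion

open Filter Topology

variable {H : Type*} [Group H] {X : Type*} [MetricSpace X] [MulAction H X]
  {C D E : SubMulAction H X} {x y m : X}

variable (H X) in
/-- The union of all minimal closed convex `H`-invariant sets. -/
def minimalUnion : Set X :=
  {x | IsMinimalConvex (leaf H x)}

lemma IsMinimalConvex.subset_minimalUnion (hC : IsMinimalConvex C) :
    (C : Set X) ⊆ minimalUnion H X := by
  intro x hx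
  rwa [minimalUnion, Set.mem_ofPred_eq, hC.leaf_eq hx]

variable [CompleteSpace X] [IsIsometricSMul H X]

lemma exists_isometry_tendsto {Y : Type*} [MetricSpace Y] [MulAction H Y] {g : ℕ → Y →[H] X}
    (hg : ∀ n, Isometry (g n)) (hcauchy : ∀ y, CauchySeq fun n => g n y) :
    ∃ f : Y →[H] X, Isometry f ∧ ∀ y, Tendsto (fun n => g n y) atTop (𝓝 (f y)) := by
  choose f hf using fun y => cauchySeq_tendsto_of_complete (hcauchy y)
  refine ⟨⟨f, fun h y => tendsto_nhds_unique (hf (h • y)) ?_⟩,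
    Isometry.of_dist_eq fun y z => tendsto_nhds_unique ((hf y).dist (hf z)) ?_, hf⟩
  · simp only [map_smul]
    exact (hf y).const_smul h
  · simp only [(hg _).dist_eq]
    exact tendsto_const_nhds

variable (hX : IsCATZero X)
include hX

lemma IsMinimalConvex.dist_proj_proj_le_dist (hC : IsMinimalConvex C) (hD : IsMinimalConvex D)
    (hE : IsMinimalConvex E) {z : X} (hz : z ∈ C) (hx : x ∈ D) (hy : y ∈ E) :
    dist (proj (D : Set X) z) (proj (E : Set X) z) ≤ dist x y := by
  rw [← hC.proj_comp_proj hX hD hE hz, hX.dist_proj hE.prop,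
    hD.infDist_eq hX hE.prop (hX.proj_mem hD.prop z) hx]
  exact Metric.infDist_le_dist_of_mem hy

lemma IsCATZero.isClosed_minimalUnion : IsClosed (minimalUnion H X) := by
  refine isClosed_of_closure_subset fun x hx => ?_
  obtain ⟨u, hu, hux⟩ := mem_closure_iff_seq_limit.1 hx
  let C (n : ℕ) : SubMulAction H X := leaf H (u n)
  have hC (n : ℕ) : IsMinimalConvex (C n) := hu n
  let g (n : ℕ) : C 0 →[H] X := (C n).subtype.comp (projHom hX (hC n).prop (C 0))
  have hg (n : ℕ) : Isometry (g n) :=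
    isometry_subtype_coe.comp ((hC 0).isometry_projHom hX (hC n))
  have hcauchy (y : C 0) : CauchySeq fun n => g n y := by
    refine Metric.cauchySeq_iff.2 fun ε hε => ?_
    obtain ⟨N, hN⟩ := Metric.cauchySeq_iff.1 hux.cauchySeq ε hε
    exact ⟨N, fun i hi j hj => ((hC 0).dist_proj_proj_le_dist hX (hC i) (hC j) y.2
      (mem_leaf (u i)) (mem_leaf (u j))).trans_lt (hN i hi j hj)⟩
  obtain ⟨f, hf, hlim⟩ := exists_isometry_tendsto hg hcauchy
  refine ((hC 0).equivariantRange hX hf).subset_minimalUnion ?_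
  let y : C 0 := ⟨proj (C 0 : Set X) x, hX.proj_mem (hC 0).prop x⟩
  have hle (n : ℕ) : dist (u n) (g n y) ≤ dist (u n) x := by
    rw [← (hC n).proj_proj hX (hC 0) (mem_leaf (u n))]
    refine (hX.dist_proj_proj_le (hC n).prop _ _).trans ?_
    rw [(hC n).proj_proj hX (hC 0) (mem_leaf (u n))]
    exact hX.dist_proj_proj_le (hC 0).prop _ _
  have hxy : Tendsto (fun n => g n y) atTop (𝓝 x) :=
    (tendsto_iff_of_dist (squeeze_zero (fun _ => dist_nonneg) hle
      (tendsto_iff_dist_tendsto_zero.1 hux))).1 hux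
  exact ⟨y, tendsto_nhds_unique (hlim y) hxy⟩

section Midpoints

variable (hC : IsMinimalConvex C) (hD : IsMinimalConvex D)
include hC hD

lemma IsMinimalConvex.proj_eq_of_isMidpoint (hx : x ∈ C)
    (hm : IsMidpoint m x (proj (D : Set X) x)) : proj (C : Set X) m = x := by
  have hnear := hX.isNearestPoint_proj hC.prop (proj (D : Set X) x)
  rw [hC.proj_proj hX hD hx] at hnear
  exact hX.proj_eq hC.prop (hnear.isMidpoint hm.symm)

lemma IsMinimalConvex.mem_minimalUnion_of_isMidpoint_proj (hx : x ∈ C)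
    (hm : IsMidpoint m x (proj (D : Set X) x)) : m ∈ minimalUnion H X := by
  choose f hf using fun z : C => hX.exists_isMidpoint (z : X) (proj (D : Set X) z)
  let F : C →[H] X := ⟨f, fun h z => hX.isMidpoint_unique (hf (h • z)) <| by
    rw [SubMulAction.val_smul, hX.proj_smul hD.prop]
    exact (hf z).map (isometry_smul X h)⟩
  have hF : Isometry F := Isometry.of_dist_eq fun z w => by
    refine le_antisymm ?_ ?_
    · have hle := hX.dist_isMidpoint_le (hf z) (hf w)
      rwa [hC.dist_proj_proj hX hD z.2 w.2, add_self_div_two] at hle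
    · have hle := hX.dist_proj_proj_le hC.prop (f z) (f w)
      rwa [hC.proj_eq_of_isMidpoint hX hD z.2 (hf z),
        hC.proj_eq_of_isMidpoint hX hD w.2 (hf w)] at hle
  exact (hC.equivariantRange hX hF).subset_minimalUnion
    ⟨⟨x, hx⟩, hX.isMidpoint_unique (hf ⟨x, hx⟩) hm⟩

/-- In the flat rectangle spanned by `x` and `y`, the centre is the midpoint of either diagonal
and of either median. -/
lemma IsMinimalConvex.isMidpoint_of_isMidpoint_proj (hx : x ∈ C) (hy : y ∈ D) {n : X}
    (hm : IsMidpoint m x (proj (C : Set X) y)) (hn : IsMidpoint n m (proj (D : Set X) m)) :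
    IsMidpoint n x y := by
  have hyC : proj (C : Set X) y ∈ C := hX.proj_mem hC.prop y
  have hmC : m ∈ C := hC.prop.midpointConvex hx hyC hm
  have hwidth : Metric.infDist m D = Metric.infDist x D := hC.infDist_eq hX hD.prop hmC hx
  have hside {z : X} (hz : z ∈ C) : dist (proj (D : Set X) z) y = dist z (proj (C : Set X) y) := by
    rw [← hC.dist_proj_proj hX hD hz hyC, hD.proj_proj hX hC hy]
  have hxy := hC.sq_dist_eq hX hD hx hy
  have hxm := hC.sq_dist_eq hX hD hx (hX.proj_mem hD.prop m)
  have hmy := hC.sq_dist_eq hX hD hmC hy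
  have hyp := dist_comm (proj (D : Set X) m) y
  rw [hside hx] at hxy
  rw [hC.dist_proj_proj hX hD hx hmC, hm.dist_left] at hxm
  rw [hside hmC, dist_comm m (proj _ _), hm.dist_right, hwidth, dist_comm m y] at hmy
  rw [hside hmC, dist_comm m (proj _ _), hm.dist_right] at hyp
  have hxn := hX.bruhat_tits_isMidpoint hn x
  have hyn := hX.bruhat_tits_isMidpoint hn y
  rw [hX.dist_proj hD.prop, hwidth, hxm, hm.dist_left] at hxn
  rw [hX.dist_proj hD.prop, hwidth, hmy, ← hyp] at hyn
  exact isMidpoint_of_sq_add_sq_le (by linarith)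

end Midpoints

lemma IsCATZero.midpointConvex_minimalUnion : MidpointConvex (minimalUnion H X) := by
  intro x (hx : IsMinimalConvex (leaf H x)) y (hy : IsMinimalConvex (leaf H y)) n hn
  obtain ⟨m, hm⟩ := hX.exists_isMidpoint x (proj (leaf H x : Set X) y)
  obtain ⟨n', hn'⟩ := hX.exists_isMidpoint m (proj (leaf H y : Set X) m)
  have hmC : m ∈ leaf H x :=
    hx.prop.midpointConvex (mem_leaf x) (hX.proj_mem hx.prop y) hm
  rw [hX.isMidpoint_unique hn
    (hx.isMidpoint_of_isMidpoint_proj hX hy (mem_leaf x) (mem_leaf y) hm hn')]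
  exact hx.mem_minimalUnion_of_isMidpoint_proj hX hy hmC hn'

end MinimalUnion

section Translates

variable {H K : Type*} [Group H] [Group K] {X : Type*} [MulAction H X]
  [MulAction K X] [SMulCommClass H K X]
  {C D : SubMulAction H X} {x : X}

/-- The translate of an `H`-invariant set by an element of a group commuting with `H`. -/
def translate (k : K) (C : SubMulAction H X) : SubMulAction H X :=
  equivariantRange (⟨fun c => k • (c : X), fun h c => (smul_comm h k (c : X)).symm⟩ : C →[H] X)

lemma coe_translate (k : K) (C : SubMulAction H X) :
    (translate k C : Set X) = (k • ·) '' (C : Set X) :=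
  (Set.image_eq_range _ _).symm

lemma smul_mem_translate (k : K) (hx : x ∈ C) : k • x ∈ translate k C :=
  ⟨⟨x, hx⟩, rfl⟩

variable [MetricSpace X] [CompleteSpace X] [IsIsometricSMul K X] (hX : IsCATZero X)
include hX

lemma IsMinimalConvex.isMinimalConvex_translate (hC : IsMinimalConvex C) (k : K) :
    IsMinimalConvex (translate k C) :=
  hC.equivariantRange hX ((isometry_smul X k).comp isometry_subtype_coe)

lemma IsMinimalConvex.proj_translate_smul (hC : IsMinimalConvex C) (k : K) (x : X) :
    proj (translate k C : Set X) (k • x) = k • proj (C : Set X) x :=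
  hX.proj_eq (hC.isMinimalConvex_translate hX k).prop <| by
    rw [coe_translate]
    exact (hX.isNearestPoint_proj hC.prop x).image (isometry_smul X k)

lemma IsMinimalConvex.leaf_smul (hL : IsMinimalConvex (leaf H x)) (k : K) :
    leaf H (k • x) = translate k (leaf H x) :=
  (hL.isMinimalConvex_translate hX k).leaf_eq (smul_mem_translate k (mem_leaf x))

variable [IsIsometricSMul H X]

lemma IsMinimalConvex.dist_smul_eq (hC : IsMinimalConvex C) (k : K) (x y : C) :
    dist (k • (x : X)) x = dist (k • (y : X)) y :=
  hC.apply_eq_apply hX (φ := fun z : C => dist (k • (z : X)) z)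
    (((isometry_smul X k).continuous.comp continuous_subtype_val).dist continuous_subtype_val)
    (fun a b m hm => Set.mem_ofPred.1 <| hX.midpointConvex_setOf_dist_smul_le k _
      (Set.mem_ofPred.2 (le_max_left _ _)) (Set.mem_ofPred.2 (le_max_right _ _))
      (hm.map isometry_subtype_coe))
    (fun h z => by rw [SubMulAction.val_smul, ← smul_comm h k (z : X), dist_smul]) x y

variable (hb : ∀ S : Set X, HasBoundedDisplacement H S → HasBoundedDisplacement K S →
  Bornology.IsBounded S)
include hb

/-- The elements of `K` translate along `C` by a constant; as `K` has constant displacement on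
`C`, the orbit of such a translation would otherwise contradict `hb`. -/
lemma IsMinimalConvex.proj_smul_eq_self (hC : IsMinimalConvex C) (k : K) (hx : x ∈ C) :
    proj (C : Set X) (k • x) = x := by
  have hkC : IsMinimalConvex (translate k C) := hC.isMinimalConvex_translate hX k
  let f : C →[H] C := ⟨fun c => ⟨proj (C : Set X) (k • (c : X)), hX.proj_mem hC.prop _⟩,
    fun h c => Subtype.ext <| (congrArg (proj (C : Set X)) (smul_comm h k (c : X)).symm).trans
      (hX.proj_smul hC.prop h _)⟩
  have hf : Isometry f := Isometry.of_dist_eq fun a b =>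
    (hkC.dist_proj_proj hX hC (smul_mem_translate k a.2) (smul_mem_translate k b.2)).trans
      (dist_smul k (a : X) b)
  let a : C := ⟨x, hx⟩
  have hbdd : Bornology.IsBounded (Set.range fun n => ((f^[n] a : C) : X)) := by
    refine hb _ (fun h => ⟨dist (h • a) a, ?_⟩) fun k' => ⟨dist (k' • x) x, ?_⟩
    · rintro _ ⟨n, rfl⟩
      have hcomm : Function.Commute f (h • ·) := fun c => map_smul f h c
      have hlip := (hf.lipschitz.iterate n).dist_le_mul (h • a) a
      rwa [one_pow, NNReal.coe_one, one_mul, hcomm.iterate_left n a] at hlip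
    · rintro _ ⟨n, rfl⟩
      exact (hC.dist_smul_eq hX k' (f^[n] a) a).le
  obtain ⟨R, hR⟩ := hbdd.subset_closedBall x
  have hle (n : ℕ) : n * dist a (f a) ≤ R := by
    rw [← hC.dist_iterate hX hf, dist_comm]
    exact hR ⟨n, rfl⟩
  have hfix : dist a (f a) = 0 := (nonpos_of_forall_nat_mul_le hle).antisymm dist_nonneg
  exact congrArg Subtype.val (dist_eq_zero.1 hfix).symm

lemma IsMinimalConvex.smul_proj (hC : IsMinimalConvex C) (hD : IsMinimalConvex D) (k : K)
    (hx : x ∈ C) : k • proj (D : Set X) x = proj (translate k D : Set X) x := by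
  rw [← hD.proj_translate_smul hX, ← (hC.isMinimalConvex_translate hX k).proj_comp_proj hX hC
    (hD.isMinimalConvex_translate hX k) (smul_mem_translate k hx),
    hC.proj_smul_eq_self hX hb k hx]

end Translates

section ProductMaps

variable {X Y T : Type*} [MetricSpace X] [MetricSpace Y] [MetricSpace T]

lemma sq_dist_withLp (p q : WithLp 2 (Y × T)) :
    dist p q ^ 2 = dist p.fst q.fst ^ 2 + dist p.snd q.snd ^ 2 := by
  rw [WithLp.prod_dist_eq_add (by norm_num), ENNReal.toReal_ofNat, ← Real.sqrt_eq_rpow,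
    Real.sq_sqrt (by positivity), Real.rpow_two, Real.rpow_two]

lemma exists_isMidpoint_withLp (hY : ∀ a b : Y, ∃ m, IsMidpoint m a b)
    (hT : ∀ a b : T, ∃ m, IsMidpoint m a b) (p q : WithLp 2 (Y × T)) :
    ∃ m, IsMidpoint m p q := by
  obtain ⟨a, ha⟩ := hY p.fst q.fst
  obtain ⟨b, hb⟩ := hT p.snd q.snd
  refine ⟨WithLp.toLp 2 (a, b), isMidpoint_of_sq_add_sq_le ?_⟩
  simp only [sq_dist_withLp, WithLp.toLp_fst, WithLp.toLp_snd, ha.dist_left, ha.dist_right,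
    hb.dist_left, hb.dist_right]
  exact le_of_eq (by ring)

variable {H K : Type*} [SMul H X] [SMul H Y] [SMul K X] [SMul K T]

variable (H K) in
/-- `ψ` embeds the `ℓ²`-product of an `H`-space `Y` and a `K`-space `T` equivariantly and
isometrically in `X`. It is curried, and Pythagoras is spelled out, so as not to put actions on
`WithLp 2 (Y × T)`. -/
structure IsProductMap (ψ : Y → T → X) : Prop where
  sq_dist_eq : ∀ y t y' t', dist (ψ y t) (ψ y' t') ^ 2 = dist y y' ^ 2 + dist t t' ^ 2
  map_smul_left : ∀ (h : H) y t, ψ (h • y) t = h • ψ y t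
  map_smul_right : ∀ (k : K) y t, ψ y (k • t) = k • ψ y t

variable {ψ : Y → T → X} (hψ : IsProductMap H K ψ)
include hψ

lemma IsProductMap.isometry : Isometry fun p : WithLp 2 (Y × T) => ψ p.fst p.snd :=
  Isometry.of_dist_eq fun p q => (pow_left_inj₀ dist_nonneg dist_nonneg two_ne_zero).1 <|
    (hψ.sq_dist_eq _ _ _ _).trans (sq_dist_withLp p q).symm

lemma IsProductMap.isometry_right (y : Y) : Isometry (ψ y) :=
  Isometry.of_dist_eq fun t t' => (pow_left_inj₀ dist_nonneg dist_nonneg two_ne_zero).1 <| by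
    rw [hψ.sq_dist_eq, dist_self, zero_pow two_ne_zero, zero_add]

lemma IsProductMap.isometry_left (t : T) : Isometry (ψ · t) :=
  Isometry.of_dist_eq fun y y' => (pow_left_inj₀ dist_nonneg dist_nonneg two_ne_zero).1 <| by
    rw [hψ.sq_dist_eq, dist_self, zero_pow two_ne_zero, add_zero]

lemma IsProductMap.isClosedConvex_range (hX : IsCATZero X) [CompleteSpace Y] [CompleteSpace T]
    [Nonempty Y] [Nonempty T] (hY : ∀ a b : Y, ∃ m, IsMidpoint m a b)
    (hT : ∀ a b : T, ∃ m, IsMidpoint m a b) : IsClosedConvex (Set.range (Function.uncurry ψ)) := by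
  have : Nonempty (WithLp 2 (Y × T)) := (WithLp.equiv 2 (Y × T)).nonempty
  rw [← (WithLp.equiv 2 (Y × T)).surjective.range_comp]
  exact hX.isClosedConvex_range (exists_isMidpoint_withLp hY hT) hψ.isometry

end ProductMaps

section TwoFactors

variable {H K : Type*} [Group H] [Group K] {X Y T : Type*} [MetricSpace X] [MetricSpace Y]
  [MetricSpace T] [MulAction H X] [MulAction H Y] [MulAction K X] [MulAction K T]
  {ψ : Y → T → X}

lemma IsProductMap.comp_subtype (hψ : IsProductMap H K ψ) (S : SubMulAction K T) :
    IsProductMap H K fun y (t : S) => ψ y t where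
  sq_dist_eq y t y' t' := hψ.sq_dist_eq y t y' t'
  map_smul_left h y t := hψ.map_smul_left h y t
  map_smul_right k y t := hψ.map_smul_right k y t

/-- A set in `T` on which `K` has bounded displacement embeds in a slice `{y} × T`, on which each
element of `H` has constant displacement. -/
lemma IsProductMap.not_isEvanescent [Nonempty Y] (hψ : IsProductMap H K ψ)
    (hb : ∀ S : Set X, HasBoundedDisplacement H S → HasBoundedDisplacement K S →
      Bornology.IsBounded S) : ¬IsEvanescent K T := by
  rintro ⟨S, hS, hunbdd⟩
  obtain ⟨y⟩ := ‹Nonempty Y›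
  refine hunbdd <| ((hψ.isometry_right y).antilipschitz.isBounded_preimage ?_).subset
    (Set.subset_preimage_image (ψ y) S)
  refine hb _ (fun h => ⟨dist (h • y) y, ?_⟩) fun k => ?_
  · rintro _ ⟨t, -, rfl⟩
    rw [← hψ.map_smul_left, (hψ.isometry_left t).dist_eq]
  · obtain ⟨B, hB⟩ := hS k
    refine ⟨B, ?_⟩
    rintro _ ⟨t, ht, rfl⟩
    rw [← hψ.map_smul_right, (hψ.isometry_right y).dist_eq]
    exact hB t ht

end TwoFactors

section ProductDecomposition

variable {H K : Type*} [Group H] [Group K] {X : Type*} [MetricSpace X] [CompleteSpace X]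
  [MulAction H X] [MulAction K X] [IsIsometricSMul H X] {C D E : SubMulAction H X} {x y t : X}
  (hX : IsCATZero X)
include hX

lemma IsMinimalConvex.sq_dist_eq_add_sq_dist_proj (hC : IsMinimalConvex C) (hD : IsMinimalConvex D)
    (hE : IsMinimalConvex E) {z : X} (hx : x ∈ D) (hy : y ∈ E) (hz : z ∈ C) :
    dist x y ^ 2 = dist (proj (C : Set X) x) (proj (C : Set X) y) ^ 2 +
      dist (proj (D : Set X) z) (proj (E : Set X) z) ^ 2 := by
  rw [hD.sq_dist_eq hX hE hx hy, hD.infDist_eq hX hE.prop hx (hX.proj_mem hD.prop z),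
    ← hX.dist_proj hE.prop, hC.proj_comp_proj hX hD hE hz,
    ← hE.dist_proj_proj hX hC (hX.proj_mem hE.prop x) hy, hD.proj_comp_proj hX hE hC hx]

/-- The points of the minimal sets which project to `x` in `C`; for `x` in the minimal set `C`
this is a cross-section of the family of minimal sets. -/
def crossSection (C : SubMulAction H X) (x : X) : Set X :=
  {t ∈ minimalUnion H X | proj (C : Set X) t = x}

lemma IsMinimalConvex.proj_leaf_of_mem_crossSection (hC : IsMinimalConvex C)
    (ht : t ∈ crossSection C x) : proj (leaf H t : Set X) x = t := by
  have hL : IsMinimalConvex (leaf H t) := ht.1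
  rw [← ht.2, hL.proj_proj hX hC (mem_leaf t)]

lemma IsMinimalConvex.isClosedConvex_crossSection (hC : IsMinimalConvex C) (hx : x ∈ C) :
    IsClosedConvex (crossSection C x) where
  nonempty := ⟨x, hC.subset_minimalUnion hx, hX.proj_eq_self hC.prop hx⟩
  isClosed := hX.isClosed_minimalUnion.inter
    (isClosed_eq (hX.continuous_proj hC.prop) continuous_const)
  midpointConvex := by
    intro s hs t ht m hm
    have hmU : m ∈ minimalUnion H X := hX.midpointConvex_minimalUnion hs.1 ht.1 hm
    have hL : IsMinimalConvex (leaf H m) := hmU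
    let q := proj (leaf H m : Set X) x
    have hq {r : X} (hr : r ∈ crossSection C x) : dist r q ^ 2 ≤ dist r m ^ 2 := by
      rw [hC.sq_dist_eq_add_sq_dist_proj hX hr.1 hL (mem_leaf r) (mem_leaf m) hx,
        hC.proj_leaf_of_mem_crossSection hX hr]
      exact le_add_of_nonneg_left (sq_nonneg _)
    have hqm : IsMidpoint q s t := isMidpoint_of_sq_add_sq_le <| calc
      2 * (dist s q ^ 2 + dist t q ^ 2) ≤ 2 * (dist s m ^ 2 + dist t m ^ 2) := by
        gcongr 2 * (?_ + ?_)
        exacts [hq hs, hq ht]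
      _ = dist s t ^ 2 := by
        rw [hm.dist_left, hm.dist_right]
        ring
    refine ⟨hmU, ?_⟩
    rw [hX.isMidpoint_unique hm hqm, hC.proj_proj hX hL hx]

variable [SMulCommClass H K X] [IsIsometricSMul K X]
  (hb : ∀ S : Set X, HasBoundedDisplacement H S → HasBoundedDisplacement K S →
    Bornology.IsBounded S)
include hb

lemma IsMinimalConvex.smul_mem_crossSection (hC : IsMinimalConvex C) (hx : x ∈ C) (k : K)
    (ht : t ∈ crossSection C x) : k • t ∈ crossSection C x := by
  have hL : IsMinimalConvex (leaf H t) := ht.1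
  have hkL : IsMinimalConvex (translate k (leaf H t)) := hL.isMinimalConvex_translate hX k
  refine ⟨hkL.subset_minimalUnion (smul_mem_translate k (mem_leaf t)), ?_⟩
  rw [← hC.proj_leaf_of_mem_crossSection hX ht, hC.smul_proj hX hb hL k hx,
    hC.proj_proj hX hkL hx]

/-- The point over `c ∈ C` and `t` in the cross-section is the projection of `c` to the minimal
set through `t`. -/
lemma IsMinimalConvex.isProductMap (hC : IsMinimalConvex C) (hx : x ∈ C) {T : SubMulAction K X}
    (hT : (T : Set X) = crossSection C x) :
    IsProductMap H K fun (c : C) (t : T) => proj (leaf H (t : X) : Set X) c where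
  sq_dist_eq c t c' t' := by
    have hL : IsMinimalConvex (leaf H (t : X)) := (hT.le t.2).1
    have hL' : IsMinimalConvex (leaf H (t' : X)) := (hT.le t'.2).1
    rw [hC.sq_dist_eq_add_sq_dist_proj hX hL hL' (hX.proj_mem hL.prop _)
      (hX.proj_mem hL'.prop _) hx, hC.proj_proj hX hL c.2, hC.proj_proj hX hL' c'.2,
      hC.proj_leaf_of_mem_crossSection hX (hT.le t.2),
      hC.proj_leaf_of_mem_crossSection hX (hT.le t'.2)]
    rfl
  map_smul_left h c t := hX.proj_smul (isClosedConvex_leaf (t : X)) h c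
  map_smul_right k c t := by
    have hL : IsMinimalConvex (leaf H (t : X)) := (hT.le t.2).1
    rw [SubMulAction.val_smul, hL.leaf_smul hX, hC.smul_proj hX hb hL k c.2]

theorem IsCATZero.exists_isProductMap [Nonempty X] :
    ∃ (C : SubMulAction H X) (T : SubMulAction K X) (ψ : C → T → X),
      IsClosedConvex (C : Set X) ∧ IsClosedConvex (T : Set X) ∧ IsProductMap H K ψ := by
  obtain ⟨C, hC⟩ := hX.exists_isMinimalConvex hb
  obtain ⟨x, hx⟩ := hC.prop.nonempty
  let T : SubMulAction K X :=
    { carrier := crossSection C x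
      smul_mem' := fun k _ ht => hC.smul_mem_crossSection hX hb hx k ht }
  exact ⟨C, T, _, hC.prop, hC.isClosedConvex_crossSection hX hx, hC.isProductMap hX hb hx rfl⟩

end ProductDecomposition

section Splitting

variable {n : ℕ}

lemma splitsEquivariantly_succ {G : Fin (n + 1) → Type v} [∀ i, Group (G i)] {Y T Z : Type u}
    [MetricSpace Y] [MulAction (G 0) Y] [IsIsometricSMul (G 0) Y] [MetricSpace T]
    [MulAction (∀ i : Fin n, G i.succ) T] [MetricSpace Z] [MulAction (∀ i, G i) Z]
    (hT : SplitsEquivariantly (fun i : Fin n => G i.succ) T) (e : Y × T ≃ Z)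
    (he : ∀ p q, dist (e p) (e q) ^ 2 = dist p.1 q.1 ^ 2 + dist p.2 q.2 ^ 2)
    (hsmul : ∀ (g : ∀ i, G i) y t, e (g 0 • y, Fin.tail g • t) = g • e (y, t)) :
    SplitsEquivariantly G Z := by
  obtain ⟨W, hW, hact, hiso, φ, hφ, hequiv⟩ := hT
  let W' : Fin (n + 1) → Type u := Fin.cons Y W
  let hW' : ∀ i, MetricSpace (W' i) := Fin.cases ‹MetricSpace Y› hW
  let hact' : ∀ i, MulAction (G i) (W' i) := Fin.cases ‹MulAction (G 0) Y› hact
  have hiso' : ∀ i, IsIsometricSMul (G i) (W' i) := Fin.cases ‹IsIsometricSMul (G 0) Y› hiso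
  let χ : Y × T ≃ ∀ i, W' i := ((Equiv.refl Y).prodCongr φ).trans (Fin.consEquiv W')
  have hχ (p : Y × T) : (e.symm.trans χ) (e p) = Fin.cons p.1 (φ p.2) :=
    congrArg χ (e.symm_apply_apply p)
  refine ⟨W', hW', hact', hiso', e.symm.trans χ, fun z w => ?_, fun g z i => ?_⟩
  · obtain ⟨p, rfl⟩ := e.surjective z
    obtain ⟨q, rfl⟩ := e.surjective w
    rw [he, hφ, Fin.sum_univ_succ, hχ, hχ]
    rfl
  · obtain ⟨⟨y, t⟩, rfl⟩ := e.surjective z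
    rw [← hsmul, hχ, hχ]
    cases i using Fin.cases with
    | zero => rfl
    | succ i => exact hequiv (Fin.tail g) t i

lemma exists_splitsEquivariantly_zero (G : Fin 0 → Type v) [∀ i, Group (G i)] {X : Type u}
    [MetricSpace X] [MulAction (∀ i, G i) X] (x : X) :
    ∃ Z : SubMulAction (∀ i, G i) X, IsClosedConvex (Z : Set X) ∧ SplitsEquivariantly G Z := by
  let Z : SubMulAction (∀ i, G i) X :=
    { carrier := {x}
      smul_mem' := fun g y hy => by rwa [Subsingleton.elim g 1, one_smul] }
  let _ : Unique Z := Set.uniqueSingleton x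
  refine ⟨Z, ⟨Set.singleton_nonempty x, isClosed_singleton, ?_⟩, fun _ => PUnit,
    fun _ => inferInstance, fun i => i.elim0, fun i => i.elim0, Equiv.ofUnique _ _, fun z w => ?_,
    fun _ _ i => i.elim0⟩
  · intro a ha b hb m hm
    obtain rfl : a = x := ha
    obtain rfl : b = a := hb
    have := hm.dist_left
    rw [dist_self, zero_div, dist_eq_zero] at this
    exact this.symm
  · rw [Subsingleton.elim z w, dist_self, zero_pow two_ne_zero, Fin.sum_univ_zero]

variable {G : Fin (n + 1) → Type v} [∀ i, Group (G i)] {X : Type u} [MetricSpace X]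
  [MulAction (∀ i, G i) X] [MulAction (G 0) X]
  [MulAction (∀ i : Fin n, G i.succ) X]

lemma IsProductMap.exists_splitsEquivariantly (hX : IsCATZero X)
    (hG : ∀ (g : ∀ i, G i) (x : X), g • x = g 0 • Fin.tail g • x) {Y T : Type u} [MetricSpace Y]
    [CompleteSpace Y] [Nonempty Y] [MulAction (G 0) Y] [IsIsometricSMul (G 0) Y] [MetricSpace T]
    [CompleteSpace T] [Nonempty T] [MulAction (∀ i : Fin n, G i.succ) T] {ψ : Y → T → X}
    (hψ : IsProductMap (G 0) (∀ i : Fin n, G i.succ) ψ) (hY : ∀ a b : Y, ∃ m, IsMidpoint m a b)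
    (hT : ∀ a b : T, ∃ m, IsMidpoint m a b)
    (hsplit : SplitsEquivariantly (fun i : Fin n => G i.succ) T) :
    ∃ Z : SubMulAction (∀ i, G i) X, IsClosedConvex (Z : Set X) ∧ SplitsEquivariantly G Z := by
  have hsmul (g : ∀ i, G i) (y : Y) (t : T) : ψ (g 0 • y) (Fin.tail g • t) = g • ψ y t := by
    rw [hψ.map_smul_left, hψ.map_smul_right, ← hG]
  let Z : SubMulAction (∀ i, G i) X :=
    { carrier := Set.range (Function.uncurry ψ)
      smul_mem' := by
        rintro g _ ⟨⟨y, t⟩, rfl⟩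
        exact ⟨(g 0 • y, Fin.tail g • t), hsmul g y t⟩ }
  refine ⟨Z, hψ.isClosedConvex_range hX hY hT, ?_⟩
  have hinj : Function.Injective (Function.uncurry ψ) :=
    hψ.isometry.injective.comp (WithLp.equiv 2 (Y × T)).symm.injective
  exact splitsEquivariantly_succ hsplit (Equiv.ofInjective _ hinj)
    (fun p q => hψ.sq_dist_eq p.1 p.2 q.1 q.2) fun g y t => Subtype.ext (hsmul g y t)

end Splitting

section HeadTail

variable {n : ℕ} (G : Fin (n + 1) → Type v) [∀ i, Group (G i)]

/-- The inclusion of the product of all factors but the first in the product of all factors. -/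
def tailHom : (∀ i : Fin n, G i.succ) →* ∀ i, G i where
  toFun := Fin.cons 1
  map_one' := Fin.cons_self_tail 1
  map_mul' _ _ := funext <| Fin.cases (one_mul (1 : G 0)).symm fun _ => rfl

variable {G}

lemma tailHom_zero (k : ∀ i : Fin n, G i.succ) : tailHom G k 0 = 1 := rfl

lemma tailHom_succ (k : ∀ i : Fin n, G i.succ) (i : Fin n) : tailHom G k i.succ = k i := rfl

lemma mulSingle_mul_tailHom (g : ∀ i, G i) :
    MonoidHom.mulSingle G 0 (g 0) * tailHom G (Fin.tail g) = g :=
  funext <| Fin.cases (by simp [tailHom_zero]) fun i => by simp [tailHom_succ, Fin.tail]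

lemma commute_mulSingle_tailHom (h : G 0) (k : ∀ i : Fin n, G i.succ) :
    Commute (MonoidHom.mulSingle G 0 h) (tailHom G k) :=
  funext <| Fin.cases (by simp [tailHom_zero]) fun i => by simp

lemma HasBoundedDisplacement.of_forall_exists_smul_smul {Γ H K X : Type*} [Group Γ] [Group H]
    [Group K] [MetricSpace X] [MulAction Γ X] [MulAction H X] [MulAction K X] [IsIsometricSMul H X]
    (hΓ : ∀ g : Γ, ∃ (h : H) (k : K), ∀ x : X, g • x = h • k • x) {S : Set X}
    (hH : HasBoundedDisplacement H S) (hK : HasBoundedDisplacement K S) :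
    HasBoundedDisplacement Γ S := by
  intro g
  obtain ⟨h, k, hg⟩ := hΓ g
  obtain ⟨B, hB⟩ := hH h
  obtain ⟨B', hB'⟩ := hK k
  refine ⟨B' + B, fun x hx => ?_⟩
  calc dist (g • x) x ≤ dist (h • k • x) (h • x) + dist (h • x) x := by
        rw [hg]
        exact dist_triangle _ _ _
    _ ≤ B' + B := by
        rw [dist_smul]
        exact add_le_add (hB' x hx) (hB x hx)

end HeadTail

theorem IsCATZero.exists_splitsEquivariantly_of_not_isEvanescent {n : ℕ} {G : Fin n → Type v}
    [∀ i, Group (G i)] {X : Type u} [MetricSpace X] [CompleteSpace X] [Nonempty X]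
    (hX : IsCATZero X) [MulAction (∀ i, G i) X] [IsIsometricSMul (∀ i, G i) X]
    (hG : ¬IsEvanescent (∀ i, G i) X) :
    ∃ Z : SubMulAction (∀ i, G i) X, IsClosedConvex (Z : Set X) ∧ SplitsEquivariantly G Z := by
  induction n generalizing X with
  | zero => exact exists_splitsEquivariantly_zero G (Classical.arbitrary X)
  | succ n ih =>
    let _ : MulAction (G 0) X := MulAction.compHom X (MonoidHom.mulSingle G 0)
    let _ : MulAction (∀ i : Fin n, G i.succ) X := MulAction.compHom X (tailHom G)
    have : IsIsometricSMul (G 0) X := ⟨fun h => isometry_smul X (MonoidHom.mulSingle G 0 h)⟩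
    have : IsIsometricSMul (∀ i : Fin n, G i.succ) X := ⟨fun k => isometry_smul X (tailHom G k)⟩
    have : SMulCommClass (G 0) (∀ i : Fin n, G i.succ) X :=
      ⟨fun h k x => (mul_smul _ _ x).symm.trans <|
        (congrArg (· • x) (commute_mulSingle_tailHom h k).eq).trans (mul_smul _ _ x)⟩
    have hsmul (g : ∀ i, G i) (x : X) : g • x = g 0 • Fin.tail g • x := by
      conv_lhs => rw [← mulSingle_mul_tailHom g, mul_smul]
      rfl
    have hb (S : Set X) (hH : HasBoundedDisplacement (G 0) S)
        (hK : HasBoundedDisplacement (∀ i : Fin n, G i.succ) S) : Bornology.IsBounded S :=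
      by_contra fun hS =>
        hG ⟨S, .of_forall_exists_smul_smul (fun g => ⟨_, _, hsmul g⟩) hH hK, hS⟩
    obtain ⟨C, T, ψ, hC, hT, hψ⟩ := hX.exists_isProductMap hb
    have : Nonempty C := hC.nonempty.to_subtype
    have : Nonempty T := hT.nonempty.to_subtype
    have : CompleteSpace C := hC.isClosed.completeSpace_coe
    have : CompleteSpace T := hT.isClosed.completeSpace_coe
    have hTcat : IsCATZero T := hX.subtype hT.isConvex
    obtain ⟨Z, hZ, hsplit⟩ := ih hTcat (hψ.not_isEvanescent hb)
    have : Nonempty Z := hZ.nonempty.to_subtype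
    have : CompleteSpace Z := hZ.isClosed.completeSpace_coe
    exact (hψ.comp_subtype Z).exists_splitsEquivariantly hX hsmul
      (hX.subtype hC.isConvex).exists_isMidpoint (hTcat.subtype hZ.isConvex).exists_isMidpoint
      hsplit

end CATZero

theorem corollary10_general {n : ℕ} (G : Fin n → Type*) [∀ i, Group (G i)]
    (X : Type*) [MetricSpace X] [CompleteSpace X] [Nonempty X] (hX : CATZero.IsCATZero X)
    [MulAction (∀ i, G i) X] [IsIsometricSMul (∀ i, G i) X] :
    CATZero.IsEvanescent (∀ i, G i) X ∨
      ∃ Z : SubMulAction (∀ i, G i) X,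
        (Z : Set X).Nonempty ∧ IsClosed (Z : Set X) ∧ CATZero.IsConvex (Z : Set X) ∧
          CATZero.SplitsEquivariantly G Z := by
  refine or_iff_not_imp_left.2 fun hG => ?_
  obtain ⟨Z, hZ, hsplit⟩ := hX.exists_splitsEquivariantly_of_not_isEvanescent hG
  exact ⟨Z, hZ.nonempty, hZ.isClosed, hZ.isConvex, hsplit⟩

theorem corollary10 {n : ℕ} (G : Fin n → Type*) [∀ i, Group (G i)]
    (X : Type*) [MetricSpace X] [ProperSpace X] [Nonempty X] (hX : CATZero.IsCATZero X)
    [MulAction (∀ i, G i) X] [IsIsometricSMul (∀ i, G i) X] :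
    (∃ ξ : CATZero.Boundary X, ∀ g : ∀ i, G i, g • ξ = ξ) ∨
      ∃ Z : SubMulAction (∀ i, G i) X,
        (Z : Set X).Nonempty ∧ IsClosed (Z : Set X) ∧ CATZero.IsConvex (Z : Set X) ∧
          CATZero.SplitsEquivariantly G Z := by
  exact (corollary10_general G X hX).imp_left hX.exists_fixedPoint_of_isEvanescent
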